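/- Let $(X,\mu)$ be a $\sigma$-finite measure space and let $p:(0,\infty)\times X\times X\to[0,\infty)$ be a pointwise consistent $\mu$-heat kernel, that is, $p$ is (jointly) measurable and satisfies - $p(t+s,x,y)=\int_X p(t,x,z)\,p(s,z,y)\,d\mu(z)$ for all $t,s>0$ and all $x,y\in X$, - $p(t,x,y)=p(t,y,x)$ for all $t>0$ and all $x,y\in X$, - $\int_X p(t,x,y)\,d\mu(y)\le 1$ for all $t>0$ and all $x\in X$, - $\lim_{t\to0+}\|P_tf-f\|_{L^2(\mu)}=0$ for all $f\in L^2(X,d\mu)$, where $P_tf(x):=\int_X p(t,x,y)f(y)\,d\mu(y)$. Here $L^2(X,d\mu)$ is the space of complex-valued functions. With $P_0:=\mathrm{id}$, the family $(P_t)_{t\ge0}$ is a strongly continuous semigroup of self-adjoint contractions in $L^2(X,d\mu)$. Let $H_p$ denote its generator, with the sign convention $P_t=e^{-tH_p}$, that is, $H_pf=\lim_{t\to0+}t^{-1}(f-P_tf)$ on the domain of all $f$ for which this limit exists in $L^2(X,d\mu)$. For a measure $\nu$ on $X$ let $L_\infty(X,d\nu)$ be the set of ($\nu$-classes of) measurable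 functions $h$ with $\nu\{|h|\ge c\}<\infty$ for all $c>0$, and let $L^\infty_\infty(X,d\nu):=L^\infty(X,d\nu)\cap L_\infty(X,d\nu)$. For a measurable function $V$ on $X$ let $\hat V$ denote the maximally defined multiplication operator $f\mapsto Vf$ in $L^2(X,d\mu)$, with domain $\{f\in L^2(X,d\mu): Vf\in L^2(X,d\mu)\}$. Let $q\in[1,\infty)$, and let $F_1:X\to(0,\infty)$ and $F_2:(0,\infty)\to(0,\infty)$ be measurable functions with $$p(t,x,x)\le F_1(x)F_2(t)\ \text{ for all } t>0,\ x\in X,\qquad \int_0^\infty e^{-t}F_2(t)^{1/(2q)}\,dt<\infty .$$ Let $V=V_1+V_2:X\to\mathbb{R}$ with real-valued $V_1,V_2$ such that either 1. $q=1$, $V_1\in L^2(X,F_1\,d\mu)$ and $V_2\in L_\infty(X,F_1\,d\mu)\cap L^\infty_\infty(X,d\mu)$, or 2. $q>1$, $F_1\equiv1$, $V_1\in L^{2q}(X,d\mu)$ and $V_2\in L^\infty_\infty(X,d\mu)$. Then for every $a>0$ the operator $H_p+a$ has a bounded everywhere defined inverse, and $\hat V(H_p+a)^{-1}$ is an everywhere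 defined compact operator in $L^2(X,d\mu)$. Moreover, the operator sum $H_p+\hat V$, which is defined on $\mathrm{Dom}(H_p)\cap\mathrm{Dom}(\hat V)$, satisfies $\mathrm{Dom}(H_p+\hat V)=\mathrm{Dom}(H_p)$, is self-adjoint and bounded from below, and $$\sigma_{\mathrm{ess}}(H_p+\hat V)=\sigma_{\mathrm{ess}}(H_p),$$ where $\sigma_{\mathrm{ess}}$ denotes the spectrum without the isolated points of the spectrum that are eigenvalues of finite multiplicity. -/

import Mathlib

open MeasureTheory Filter Topology
open scoped ENNReal NNReal

noncomputable section

namespace HeatKernel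

/-! ### Unbounded operators -/

section Operators

variable {E : Type*}

/-- The (infinitesimal) generator, with the sign convention `P t = exp (-t H)`, of a family
`P t`, `t ≥ 0`, of bounded operators: `H f = lim_{t → 0+} t⁻¹ (f - P t f)`, on the domain of all
`f` for which this limit exists in norm. -/
def generator [NormedAddCommGroup E] [NormedSpace ℂ E] (P : ℝ → E →L[ℂ] E) : E →ₗ.[ℂ] E where
  domain :=
    { carrier := {f | ∃ g, Tendsto (fun t : ℝ => (t : ℂ)⁻¹ • (f - P t f)) (𝓝[>] 0) (𝓝 g)}
      zero_mem' := ⟨0, by simp⟩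
      add_mem' := by
        rintro f₁ f₂ ⟨g₁, h₁⟩ ⟨g₂, h₂⟩
        refine ⟨g₁ + g₂, (h₁.add h₂).congr fun t => ?_⟩
        rw [map_add, ← smul_add]
        congr 1
        abel
      smul_mem' := by
        rintro c f ⟨g, h⟩
        refine ⟨c • g, (h.const_smul c).congr fun t => ?_⟩
        rw [map_smul, ← smul_sub, smul_comm] }
  toFun :=
    { toFun := fun f => f.2.choose
      map_add' := by
        rintro f₁ f₂
        refine tendsto_nhds_unique (f₁ + f₂).2.choose_spec
          ((f₁.2.choose_spec.add f₂.2.choose_spec).congr fun t => ?_)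
        rw [Submodule.coe_add, map_add, ← smul_add]
        congr 1
        abel
      map_smul' := by
        rintro c f
        refine tendsto_nhds_unique (c • f).2.choose_spec
          ((f.2.choose_spec.const_smul c).congr fun t => ?_)
        rw [Submodule.coe_smul, map_smul, ← smul_sub, smul_comm] }

variable [NormedAddCommGroup E] [NormedSpace ℂ E]

/-- `R` is the bounded everywhere defined inverse `(T - z)⁻¹` of `T - z : Dom T → E`. -/
def IsResolventAt (T : E →ₗ.[ℂ] E) (z : ℂ) (R : E →L[ℂ] E) : Prop :=
  (∀ f : E, ∃ h : R f ∈ T.domain, T ⟨R f, h⟩ - z • R f = f) ∧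
    ∀ f : T.domain, R (T f - z • (f : E)) = f

/-- The spectrum of an unbounded operator. -/
def spectrum (T : E →ₗ.[ℂ] E) : Set ℂ :=
  {z | ¬ ∃ R : E →L[ℂ] E, IsResolventAt T z R}

/-- The space `ker (T - z)`. -/
def eigenspace (T : E →ₗ.[ℂ] E) (z : ℂ) : Submodule ℂ E :=
  (LinearMap.ker (T.toFun - z • T.domain.subtype)).map T.domain.subtype

/-- The discrete spectrum: isolated points of the spectrum that are eigenvalues of finite
multiplicity. -/
def discreteSpectrum (T : E →ₗ.[ℂ] E) : Set ℂ :=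
  {z | z ∈ spectrum T ∧ ¬ AccPt z (𝓟 (spectrum T)) ∧
    eigenspace T z ≠ ⊥ ∧ FiniteDimensional ℂ (eigenspace T z)}

/-- The essential spectrum (of a self-adjoint operator). -/
def essentialSpectrum (T : E →ₗ.[ℂ] E) : Set ℂ :=
  spectrum T \ discreteSpectrum T

end Operators

/-! ### Heat kernels -/

variable {X : Type*} [MeasurableSpace X]

/-- `P_t f (x) = ∫ p(t,x,y) f(y) dμ(y)`. -/
def kernelIntegral (p : ℝ → X → X → ℝ≥0) (μ : Measure X) (t : ℝ) (f : X → ℂ) (x : X) : ℂ :=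
  ∫ y, ((p t x y : ℝ) : ℂ) * f y ∂μ

/-- Pointwise consistent `μ`-heat kernels. Only the values `p t x y` with `t > 0` matter. -/
structure IsHeatKernel (p : ℝ → X → X → ℝ≥0) (μ : Measure X) : Prop where
  measurable : Measurable fun z : Set.Ioi (0 : ℝ) × X × X => p z.1 z.2.1 z.2.2
  chapman_kolmogorov : ∀ t s : ℝ, 0 < t → 0 < s → ∀ x y : X,
    (p (t + s) x y : ℝ≥0∞) = ∫⁻ z, (p t x z : ℝ≥0∞) * (p s z y : ℝ≥0∞) ∂μ
  symm : ∀ t : ℝ, 0 < t → ∀ x y : X, p t x y = p t y x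
  lintegral_le_one : ∀ t : ℝ, 0 < t → ∀ x : X, ∫⁻ y, (p t x y : ℝ≥0∞) ∂μ ≤ 1
  tendsto_zero : ∀ f : X → ℂ, MemLp f 2 μ →
    Tendsto (fun t : ℝ => eLpNorm (fun x => kernelIntegral p μ t f x - f x) 2 μ)
      (𝓝[>] 0) (𝓝 0)

section Semigroup

variable {p : ℝ → X → X → ℝ≥0} {μ : Measure X}

theorem IsHeatKernel.measurable_two (hp : IsHeatKernel p μ) {t : ℝ} (ht : 0 < t) :
    Measurable fun z : X × X => p t z.1 z.2 :=
  hp.measurable.comp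
    (g := fun z : Set.Ioi (0 : ℝ) × X × X => p z.1 z.2.1 z.2.2)
    (f := fun z : X × X => ((⟨t, ht⟩ : Set.Ioi (0 : ℝ)), z.1, z.2)) (by fun_prop)

theorem IsHeatKernel.memLp (hp : IsHeatKernel p μ) {t : ℝ} (ht : 0 < t) (x : X) :
    MemLp (fun y => ((p t x y : ℝ) : ℂ)) 2 μ := by
  have hm : Measurable fun y => p t x y :=
    (hp.measurable_two ht).comp (measurable_const.prodMk measurable_id)
  refine ⟨by fun_prop, ?_⟩
  rw [eLpNorm_lt_top_iff_lintegral_rpow_enorm_lt_top (by norm_num) (by norm_num)]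
  have h := hp.chapman_kolmogorov t t ht ht x x
  refine lt_of_eq_of_lt ?_ (ENNReal.coe_lt_top (r := p (t + t) x x))
  rw [h]
  refine lintegral_congr fun y => ?_
  rw [hp.symm t ht y x]
  have : ‖((p t x y : ℝ) : ℂ)‖ₑ = (p t x y : ℝ≥0∞) := by
    simp [enorm_eq_nnnorm]
  rw [this]
  norm_num
  ring

theorem IsHeatKernel.integrable (hp : IsHeatKernel p μ) {t : ℝ} (ht : 0 < t) (x : X)
    {f : X → ℂ} (hf : MemLp f 2 μ) :
    Integrable (fun y => ((p t x y : ℝ) : ℂ) * f y) μ :=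
  MemLp.integrable_mul (hp.memLp ht x) hf

theorem IsHeatKernel.lintegral_sq_le (hp : IsHeatKernel p μ) [SigmaFinite μ] {t : ℝ}
    (ht : 0 < t) {f : X → ℂ} (hf : StronglyMeasurable f) :
    ∫⁻ x, ‖kernelIntegral p μ t f x‖ₑ ^ (2 : ℝ) ∂μ ≤ ∫⁻ y, ‖f y‖ₑ ^ (2 : ℝ) ∂μ := by
  have hm2 := hp.measurable_two ht
  have hm : ∀ x, Measurable fun y => p t x y := fun x =>
    hm2.comp (measurable_const.prodMk measurable_id)
  have hfm : Measurable fun y => ‖f y‖ₑ := hf.measurable.enorm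
  have key : ∀ x, ‖kernelIntegral p μ t f x‖ₑ ^ (2 : ℝ) ≤
      ∫⁻ y, (p t x y : ℝ≥0∞) * ‖f y‖ₑ ^ (2 : ℝ) ∂μ := by
    intro x
    have hhalf : ∀ a : ℝ≥0∞, a ^ (1 / 2 : ℝ) * a ^ (1 / 2 : ℝ) = a := by
      intro a
      rw [← ENNReal.rpow_add_of_nonneg _ _ (by norm_num) (by norm_num)]
      norm_num
    have hsq : ∀ a : ℝ≥0∞, (a ^ (1 / 2 : ℝ)) ^ (2 : ℝ) = a := by
      intro a
      rw [← ENNReal.rpow_mul]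
      norm_num
    have h1 : ‖kernelIntegral p μ t f x‖ₑ ≤
        ∫⁻ y, ((p t x y : ℝ≥0∞) ^ (1 / 2 : ℝ)) *
          ((p t x y : ℝ≥0∞) ^ (1 / 2 : ℝ) * ‖f y‖ₑ) ∂μ := by
      refine (enorm_integral_le_lintegral_enorm _).trans (le_of_eq ?_)
      refine lintegral_congr fun y => ?_
      rw [← mul_assoc, hhalf, enorm_mul]
      congr 1
      simp [enorm_eq_nnnorm]
    have h2 := ENNReal.lintegral_mul_le_Lp_mul_Lq μ Real.HolderConjugate.two_two
      (f := fun y => (p t x y : ℝ≥0∞) ^ (1 / 2 : ℝ))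
      (g := fun y => (p t x y : ℝ≥0∞) ^ (1 / 2 : ℝ) * ‖f y‖ₑ)
      (by have := hm x; fun_prop) (by have := hm x; fun_prop)
    have h3 := h1.trans h2
    calc ‖kernelIntegral p μ t f x‖ₑ ^ (2 : ℝ)
        ≤ _ := ENNReal.rpow_le_rpow h3 (by norm_num)
      _ = (∫⁻ y, (p t x y : ℝ≥0∞) ∂μ) * ∫⁻ y, (p t x y : ℝ≥0∞) * ‖f y‖ₑ ^ (2 : ℝ) ∂μ := by
          rw [ENNReal.mul_rpow_of_nonneg _ _ (by norm_num), hsq, hsq]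
          simp only [ENNReal.mul_rpow_of_nonneg _ _ (show (0 : ℝ) ≤ 2 by norm_num), hsq]
      _ ≤ 1 * ∫⁻ y, (p t x y : ℝ≥0∞) * ‖f y‖ₑ ^ (2 : ℝ) ∂μ :=
          mul_le_mul_left (hp.lintegral_le_one t ht x) _
      _ = _ := one_mul _
  calc ∫⁻ x, ‖kernelIntegral p μ t f x‖ₑ ^ (2 : ℝ) ∂μ
      ≤ ∫⁻ x, ∫⁻ y, (p t x y : ℝ≥0∞) * ‖f y‖ₑ ^ (2 : ℝ) ∂μ ∂μ := lintegral_mono key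
    _ = ∫⁻ y, ∫⁻ x, (p t x y : ℝ≥0∞) * ‖f y‖ₑ ^ (2 : ℝ) ∂μ ∂μ := by
        refine lintegral_lintegral_swap (Measurable.aemeasurable ?_)
        exact (measurable_coe_nnreal_ennreal.comp hm2).mul
          ((hfm.comp measurable_snd).pow_const _)
    _ = ∫⁻ y, (∫⁻ x, (p t y x : ℝ≥0∞) ∂μ) * ‖f y‖ₑ ^ (2 : ℝ) ∂μ := by
        refine lintegral_congr fun y => ?_
        have hy : Measurable fun x => (p t y x : ℝ≥0∞) :=
          measurable_coe_nnreal_ennreal.comp (hm y)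
        rw [← lintegral_mul_const _ hy]
        refine lintegral_congr fun x => ?_
        rw [hp.symm t ht x y]
    _ ≤ ∫⁻ y, 1 * ‖f y‖ₑ ^ (2 : ℝ) ∂μ :=
        lintegral_mono fun y => mul_le_mul_left (hp.lintegral_le_one t ht y) _
    _ = _ := by simp

theorem IsHeatKernel.eLpNorm_le (hp : IsHeatKernel p μ) [SigmaFinite μ] {t : ℝ}
    (ht : 0 < t) (f : Lp ℂ 2 μ) :
    eLpNorm (kernelIntegral p μ t f) 2 μ ≤ eLpNorm f 2 μ := by
  rw [eLpNorm_eq_lintegral_rpow_enorm_toReal (by norm_num) (by norm_num),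
    eLpNorm_eq_lintegral_rpow_enorm_toReal (by norm_num) (by norm_num)]
  exact ENNReal.rpow_le_rpow (hp.lintegral_sq_le ht (Lp.stronglyMeasurable f)) (by norm_num)

theorem IsHeatKernel.memLp_kernelIntegral (hp : IsHeatKernel p μ) [SigmaFinite μ] {t : ℝ}
    (ht : 0 < t) (f : Lp ℂ 2 μ) : MemLp (kernelIntegral p μ t f) 2 μ := by
  refine ⟨StronglyMeasurable.aestronglyMeasurable ?_,
    (hp.eLpNorm_le ht f).trans_lt (Lp.memLp f).2⟩
  refine StronglyMeasurable.integral_prod_right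
    (f := fun x y => ((p t x y : ℝ) : ℂ) * f y) (Measurable.stronglyMeasurable ?_)
  have := hp.measurable_two ht
  exact (Complex.measurable_ofReal.comp (measurable_coe_nnreal_real.comp this)).mul
    ((Lp.stronglyMeasurable f).measurable.comp measurable_snd)

/-- The semigroup `(P_t)_{t ≥ 0}` of contractions in `L²(X, μ)` given by a heat kernel:
`P_t f (x) = ∫ p(t,x,y) f(y) dμ(y)` for `t > 0`, and `P_0 = id` (negative times, which play no
role, give the identity too). -/
def semigroup (p : ℝ → X → X → ℝ≥0) (μ : Measure X) [SigmaFinite μ] (hp : IsHeatKernel p μ)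
    (t : ℝ) : Lp ℂ 2 μ →L[ℂ] Lp ℂ 2 μ :=
  if ht : 0 < t then
    LinearMap.mkContinuous
      { toFun := fun f => (hp.memLp_kernelIntegral ht f).toLp (kernelIntegral p μ t f)
        map_add' := by
          intro f g
          rw [← MemLp.toLp_add]
          refine MemLp.toLp_congr _ _ (Eventually.of_forall fun x => ?_)
          simp only [kernelIntegral, Pi.add_apply]
          rw [← integral_add (hp.integrable ht x (Lp.memLp f)) (hp.integrable ht x (Lp.memLp g))]
          refine integral_congr_ae ?_
          filter_upwards [Lp.coeFn_add f g] with y hy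
          rw [hy, Pi.add_apply, mul_add]
        map_smul' := by
          intro c f
          rw [RingHom.id_apply, ← MemLp.toLp_const_smul]
          refine MemLp.toLp_congr _ _ (Eventually.of_forall fun x => ?_)
          simp only [kernelIntegral, Pi.smul_apply]
          rw [← integral_smul]
          refine integral_congr_ae ?_
          filter_upwards [Lp.coeFn_smul c f] with y hy
          rw [hy, Pi.smul_apply, smul_eq_mul, smul_eq_mul]
          ring }
      1 (by
        intro f
        rw [one_mul]
        simp only [LinearMap.coe_mk, AddHom.coe_mk, Lp.norm_toLp]
        rw [Lp.norm_def]
        exact ENNReal.toReal_mono (Lp.memLp f).2.ne (hp.eLpNorm_le ht f))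
  else ContinuousLinearMap.id ℂ _

/-- The operator `H_p` in `L²(X, μ)`: `P_t = exp (-t H_p)`. -/
def hamiltonian (p : ℝ → X → X → ℝ≥0) (μ : Measure X) [SigmaFinite μ]
    (hp : IsHeatKernel p μ) : Lp ℂ 2 μ →ₗ.[ℂ] Lp ℂ 2 μ :=
  generator (semigroup p μ hp)

end Semigroup

/-! ### Potentials -/

/-- The maximally defined multiplication operator in `L²(X, μ)` given by a function `V`. -/
def mulOperator (μ : Measure X) (V : X → ℂ) : Lp ℂ 2 μ →ₗ.[ℂ] Lp ℂ 2 μ where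
  domain :=
    { carrier := {f | MemLp (fun x => V x * f x) 2 μ}
      zero_mem' := by
        refine (MemLp.zero (ε := ℂ)).ae_eq ?_
        filter_upwards [Lp.coeFn_zero ℂ 2 μ] with x hx
        rw [hx, Pi.zero_apply, mul_zero]
      add_mem' := by
        intro f g hf hg
        refine (MemLp.add hf hg).ae_eq ?_
        filter_upwards [Lp.coeFn_add f g] with x hx
        rw [hx, Pi.add_apply, Pi.add_apply, mul_add]
      smul_mem' := by
        intro c f hf
        refine (MemLp.const_smul hf c).ae_eq ?_
        filter_upwards [Lp.coeFn_smul c f] with x hx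
        simp only [hx, Pi.smul_apply, smul_eq_mul]
        ring }
  toFun :=
    { toFun := fun f => MemLp.toLp (fun x => V x * (f : Lp ℂ 2 μ) x) f.2
      map_add' := by
        intro f g
        rw [← MemLp.toLp_add]
        refine MemLp.toLp_congr _ _ ?_
        filter_upwards [Lp.coeFn_add (f : Lp ℂ 2 μ) g] with x hx
        rw [Submodule.coe_add, hx, Pi.add_apply, Pi.add_apply, mul_add]
      map_smul' := by
        intro c f
        rw [RingHom.id_apply, ← MemLp.toLp_const_smul]
        refine MemLp.toLp_congr _ _ ?_
        filter_upwards [Lp.coeFn_smul c (f : Lp ℂ 2 μ)] with x hx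
        simp only [Submodule.coe_smul, hx, Pi.smul_apply, smul_eq_mul]
        ring }

/-- The operator sum `H_p + V` in `L²(X, μ)`, with domain `Dom H_p ∩ Dom V`. -/
def schrodinger (p : ℝ → X → X → ℝ≥0) (μ : Measure X) [SigmaFinite μ]
    (hp : IsHeatKernel p μ) (V : X → ℝ) : Lp ℂ 2 μ →ₗ.[ℂ] Lp ℂ 2 μ :=
  hamiltonian p μ hp + mulOperator μ fun x => (V x : ℂ)

/-- `h` vanishes `μ`-weakly at infinity, i.e. (the class of) `h` belongs to `L_∞(X, μ)`. -/
def VanishesWeakly (μ : Measure X) (h : X → ℝ) : Prop :=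
  AEStronglyMeasurable h μ ∧ ∀ c : ℝ, 0 < c → μ {x | c ≤ |h x|} < ∞

/-- `F₁` is an `L^q`-control function for `p`. -/
def IsControlFunction (p : ℝ → X → X → ℝ≥0) (q : ℝ) (F₁ : X → ℝ) : Prop :=
  Measurable F₁ ∧ (∀ x, 0 < F₁ x) ∧
    ∃ F₂ : ℝ → ℝ, (Measurable fun t : Set.Ioi (0 : ℝ) => F₂ t) ∧ (∀ t, 0 < t → 0 < F₂ t) ∧
      (∀ t, 0 < t → ∀ x, (p t x x : ℝ) ≤ F₁ x * F₂ t) ∧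
      IntegrableOn (fun t => Real.exp (-t) * F₂ t ^ (1 / (2 * q))) (Set.Ioi 0)

/-- The measure `F₁ dμ`. -/
def weighted (μ : Measure X) (F₁ : X → ℝ) : Measure X :=
  μ.withDensity fun x => ENNReal.ofReal (F₁ x)

end HeatKernel

end

/-! The resolvent `(H_p + a)⁻¹` is the Laplace transform `∫₀^∞ e^{-at} P_t dt`, so bounds on `W P_t`
integrate to bounds on `W (H_p + a)⁻¹`. Cauchy-Schwarz and Chapman-Kolmogorov give `|P_t f(x)|² ≤
p(2t,x,x) ‖f‖²`. Interpolated with contractivity, this yields `‖W P_t‖ ≤ ‖W‖ F₂(2t)^{1/(2q)}` with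
the norm of `W` in `L^{2q}(F₁ μ)` (`eLpNorm_mul_semigroup_le`). The same pointwise bound makes `W
P_s` Hilbert-Schmidt for bounded `W` in `L²(F₁ μ)` (`isCompactOperator_of_ae_norm_le`). Since `(H_p
+ a)⁻¹ - e^{-as} P_s (H_p + a)⁻¹` has norm at most `s`, `W (H_p + a)⁻¹` is then a norm limit of
compact operators (`exists_isCompactOperator_of_bounded`). Approximating `V₁` by simple functions
and cutting `V₂` off where it is small shows that `K_a = V (H_p + a)⁻¹` is compact, with norm
tending to zero as `a → ∞`.

For large `a`, `H_p + V + a = (1 + K_a)(H_p + a)` is therefore invertible, and its inverse differs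
from `(H_p + a)⁻¹` by a compact operator (`IsResolventAt.exists_add`). Self-adjointness follows from
symmetry and one real resolvent point, semiboundedness from a half-line of them. For the essential
spectrum, one passes to a bounded self-adjoint resolvent `B`: a point is not essential exactly when
`B - β` is left invertible modulo compact operators (`IsResolventAt.mem_essentialSpectrum_iff`),
which a compact perturbation cannot change. -/

namespace HeatKernel

/-! ### Left parametrices of bounded self-adjoint operators -/

section Parametrix

variable {E : Type*} [NormedAddCommGroup E] [InnerProductSpace ℂ E]

/-- `B - β` is invertible from the left up to a compact operator. -/
def HasLeftParametrix (B : E →L[ℂ] E) (β : ℂ) : Prop :=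
  ∃ G K : E →L[ℂ] E, IsCompactOperator K ∧ ∀ x, G (B x - β • x) = x - K x

theorem HasLeftParametrix.of_isCompactOperator_sub {B B' : E →L[ℂ] E} {β : ℂ}
    (h : HasLeftParametrix B β) (hc : IsCompactOperator (B' - B)) : HasLeftParametrix B' β := by
  obtain ⟨G, K, hK, hG⟩ := h
  refine ⟨G, K - G.comp (B' - B), hK.sub (hc.clm_comp G), fun x => ?_⟩
  have : B' x - β • x = (B x - β • x) + (B' - B) x := by
    rw [sub_apply]; abel
  rw [this, map_add, hG]
  simp only [sub_apply, ContinuousLinearMap.comp_apply]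
  abel

/-- Otherwise `β - B` is bounded below. As `β` is real, `β - B` is self-adjoint, so the orthogonal
complement of its range is its trivial kernel; dense closed range then makes it invertible. -/
theorem exists_approx_eigenvector [CompleteSpace E] {B : E →L[ℂ] E} (hB : IsSelfAdjoint B) {β : ℂ}
    (hβ : β ∈ _root_.spectrum ℂ B) {ε : ℝ} (hε : 0 < ε) :
    ∃ x, ‖x‖ = 1 ∧ ‖B x - β • x‖ ≤ ε := by
  by_contra! hcon
  have hre : β = (β.re : ℂ) := hB.mem_spectrum_eq_re hβ
  have hbd : ∀ x, ε * ‖x‖ ≤ ‖B x - β • x‖ := by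
    intro x
    rcases eq_or_ne x 0 with rfl | hx
    · simp
    have hn : 0 < ‖x‖ := norm_pos_iff.2 hx
    have h1 := hcon (((‖x‖⁻¹ : ℝ) : ℂ) • x) (by
      rw [norm_smul, Complex.norm_real, norm_inv, norm_norm, inv_mul_cancel₀ hn.ne'])
    rw [map_smul, smul_comm β, ← smul_sub, norm_smul, Complex.norm_real, norm_inv, norm_norm,
      inv_mul_eq_div, lt_div_iff₀ hn] at h1
    exact h1.le
  rw [spectrum.mem_iff] at hβ
  apply hβ
  set A : E →L[ℂ] E := algebraMap ℂ (E →L[ℂ] E) β - B with hA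
  have hAx : ∀ x, A x = β • x - B x := fun x => by
    rw [hA, sub_apply, Algebra.algebraMap_eq_smul_one]; rfl
  have hAsa : IsSelfAdjoint A := by
    refine IsSelfAdjoint.sub ?_ hB
    rw [hre]
    exact (IsSelfAdjoint.algebraMap _ (Complex.conj_ofReal _))
  have hAbd : ∀ x, ε * ‖x‖ ≤ ‖A x‖ := fun x => by
    rw [hAx, norm_sub_rev]; exact hbd x
  rw [ContinuousLinearMap.isUnit_iff_bijective,
    ContinuousLinearMap.bijective_iff_dense_range_and_antilipschitz]
  refine ⟨?_, ?_⟩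
  · rw [Submodule.topologicalClosure_eq_top_iff, ContinuousLinearMap.orthogonal_range,
      ← ContinuousLinearMap.star_eq_adjoint, hAsa.star_eq, Submodule.eq_bot_iff]
    intro x hx
    have h0 : A x = 0 := hx
    have := hAbd x
    rw [h0, norm_zero] at this
    exact norm_le_zero_iff.1 (nonpos_of_mul_nonpos_right this hε)
  · refine ⟨(ε⁻¹).toNNReal, AddMonoidHomClass.antilipschitz_of_bound A fun x => ?_⟩
    rw [Real.coe_toNNReal _ (inv_nonneg.2 hε.le), inv_mul_eq_div, le_div_iff₀ hε, mul_comm]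
    exact hAbd x

/-- Since `x = K x + G (B x - β x)`, compactness of `K` turns an approximate eigensequence into a
convergent one. -/
theorem HasLeftParametrix.exists_tendsto_eigenvector {B : E →L[ℂ] E} {β : ℂ}
    (h : HasLeftParametrix B β) {x : ℕ → E} (hx : ∀ n, ‖x n‖ = 1)
    (hBx : Tendsto (fun n => B (x n) - β • x n) atTop (𝓝 0)) :
    ∃ y, ‖y‖ = 1 ∧ B y = β • y ∧ ∃ φ : ℕ → ℕ, StrictMono φ ∧ Tendsto (x ∘ φ) atTop (𝓝 y) := by
  obtain ⟨G, K, hK, hG⟩ := h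
  obtain ⟨C, hC, hKC⟩ :=
    IsCompactOperator.image_closedBall_subset_compact (f := (K : E →ₗ[ℂ] E)) hK 1
  obtain ⟨y, -, φ, hφ, hlim⟩ := hC.tendsto_subseq (x := fun n => K (x n))
    fun n => hKC ⟨x n, by simp [hx n], rfl⟩
  have hx' : Tendsto (x ∘ φ) atTop (𝓝 y) := by
    have h1 : Tendsto (fun n => K (x (φ n)) + G (B (x (φ n)) - β • x (φ n))) atTop
        (𝓝 (y + G 0)) :=
      hlim.add ((G.continuous.tendsto 0).comp (hBx.comp hφ.tendsto_atTop))
    rw [map_zero, add_zero] at h1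
    refine h1.congr fun n => ?_
    rw [hG, add_sub_cancel]; rfl
  refine ⟨y, ?_, ?_, φ, hφ, hx'⟩
  · refine tendsto_nhds_unique hx'.norm ?_
    simp [hx]
  · have h1 : Tendsto (fun n => B (x (φ n)) - β • x (φ n)) atTop (𝓝 (B y - β • y)) :=
      ((B.continuous.tendsto y).comp hx').sub (hx'.const_smul β)
    exact sub_eq_zero.1 (tendsto_nhds_unique h1 (hBx.comp hφ.tendsto_atTop))

/-- On the eigenspace `K` is the identity, so the identity is compact there. -/
theorem HasLeftParametrix.finiteDimensional_eigenspace {B : E →L[ℂ] E} {β : ℂ}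
    (h : HasLeftParametrix B β) :
    FiniteDimensional ℂ (Module.End.eigenspace (B : E →ₗ[ℂ] E) β) := by
  obtain ⟨G, K, hK, hG⟩ := h
  set N := Module.End.eigenspace (B : E →ₗ[ℂ] E) β with hN
  have hmem : ∀ x : E, x ∈ N ↔ B x = β • x := fun x => Module.End.mem_eigenspace_iff
  have hKx : ∀ x : N, K x = x := fun x => by
    have := hG x
    rw [(hmem x).1 x.2, sub_self, map_zero] at this
    exact (sub_eq_zero.1 this.symm).symm
  have hcl : IsClosed (N : Set E) := by
    have : (N : Set E) = {x | B x = β • x} := by ext x; exact hmem x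
    rw [this]
    exact isClosed_eq B.continuous (continuous_const_smul β)
  have h1 : IsCompactOperator (fun x : N => K x) := hK.comp_clm N.subtypeL
  have h2 := h1.codRestrict (V := N) (fun x => by rw [hKx]; exact x.2) hcl
  refine FiniteDimensional.of_isCompactOperator_id (𝕜 := ℂ) ?_
  rwa [show Set.codRestrict (fun x : N => K x) N _ = id from
    funext fun x => Subtype.ext (hKx x)] at h2

theorem HasLeftParametrix.exists_eigenvector [CompleteSpace E] {B : E →L[ℂ] E}
    (hB : IsSelfAdjoint B) {β : ℂ}
    (h : HasLeftParametrix B β) (hβ : β ∈ _root_.spectrum ℂ B) :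
    Module.End.eigenspace (B : E →ₗ[ℂ] E) β ≠ ⊥ := by
  choose x hx hBx using fun n : ℕ =>
    exists_approx_eigenvector hB hβ (ε := 1 / ((n : ℝ) + 1)) (by positivity)
  obtain ⟨y, hy, hBy, -⟩ := h.exists_tendsto_eigenvector hx
    (squeeze_zero_norm hBx tendsto_one_div_add_atTop_nhds_zero_nat)
  rw [Submodule.ne_bot_iff]
  exact ⟨y, Module.End.mem_eigenspace_iff.2 hBy, fun h0 => by simp [h0] at hy⟩

/-- Spectral points `l n → β` distinct from `β` have approximate eigenvectors nearly orthogonal to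
`ker (B - β)`. A subsequence nevertheless converges to a unit vector of that kernel. -/
theorem HasLeftParametrix.not_accPt [CompleteSpace E] {B : E →L[ℂ] E} (hB : IsSelfAdjoint B) {β : ℂ}
    (h : HasLeftParametrix B β) : ¬ AccPt β (𝓟 (_root_.spectrum ℂ B)) := by
  intro hacc
  rw [accPt_iff_frequently] at hacc
  have hex : ∀ n : ℕ, ∃ l ∈ _root_.spectrum ℂ B, l ≠ β ∧ ‖l - β‖ < 1 / ((n : ℝ) + 1) := by
    intro n
    obtain ⟨l, ⟨h1, h2⟩, h3⟩ :=
      (hacc.and_eventually (Metric.ball_mem_nhds β (ε := 1 / ((n : ℝ) + 1)) (by positivity))).exists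
    exact ⟨l, h2, h1, by simpa [dist_eq_norm] using h3⟩
  choose l hl hne hlt using hex
  -- The error is taken small relative to `‖l n - β‖`, because that factor is divided out in the
  -- orthogonality estimate `hin`.
  choose x hx hBx using fun n : ℕ =>
    exists_approx_eigenvector hB (hl n) (ε := ‖l n - β‖ * (1 / ((n : ℝ) + 1)))
      (mul_pos (norm_pos_iff.2 (sub_ne_zero.2 (hne n))) (by positivity))
  have hreal : ∀ n, (starRingEnd ℂ) (l n) = l n := fun n => by
    rw [hB.mem_spectrum_eq_re (hl n), Complex.conj_ofReal]
  have h0 := tendsto_one_div_add_atTop_nhds_zero_nat (𝕜 := ℝ)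
  have hBx' : Tendsto (fun n => B (x n) - β • x n) atTop (𝓝 0) := by
    refine squeeze_zero_norm (a := fun n : ℕ => 1 / ((n : ℝ) + 1) * (1 / ((n : ℝ) + 1)) +
      1 / ((n : ℝ) + 1)) (fun n => ?_) (by simpa using (h0.mul h0).add h0)
    have e : B (x n) - β • x n = (B (x n) - l n • x n) + (l n - β) • x n := by
      rw [sub_smul]; abel
    rw [e]
    refine (norm_add_le _ _).trans (add_le_add ((hBx n).trans ?_) ?_)
    · exact mul_le_mul_of_nonneg_right (hlt n).le (by positivity)
    · rw [norm_smul, hx, mul_one]; exact (hlt n).le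
  obtain ⟨y, hy, hBy, φ, hφ, hlim⟩ := h.exists_tendsto_eigenvector hx hBx'
  have hin : ∀ n, ‖inner ℂ (x n) y‖ ≤ 1 / ((n : ℝ) + 1) := by
    intro n
    have e : inner ℂ (B (x n) - l n • x n) y = (β - l n) * inner ℂ (x n) y := by
      have := hB.isSymmetric (x n) y
      simp only [ContinuousLinearMap.coe_coe] at this
      rw [inner_sub_left, this, hBy, inner_smul_right, inner_smul_left, hreal]
      ring
    have h2 := norm_inner_le_norm (𝕜 := ℂ) (B (x n) - l n • x n) y
    rw [e, hy, mul_one, norm_mul, norm_sub_rev] at h2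
    exact le_of_mul_le_mul_left (h2.trans (hBx n)) (norm_pos_iff.2 (sub_ne_zero.2 (hne n)))
  have h1 : Tendsto (fun n => inner ℂ (x (φ n)) y) atTop (𝓝 (inner ℂ y y)) :=
    hlim.inner tendsto_const_nhds
  have h2 : Tendsto (fun n => inner ℂ (x (φ n)) y) atTop (𝓝 0) :=
    (squeeze_zero_norm hin h0).comp hφ.tendsto_atTop
  have h3 := tendsto_nhds_unique h1 h2
  rw [inner_self_eq_zero] at h3
  simp [h3] at hy

/-- The continuous functional calculus supplies `G = (B - β)⁻¹` off the point `β`, and `K` as the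
spectral projection at `β`, whose range lies in the finite-dimensional eigenspace. -/
theorem HasLeftParametrix.of_not_accPt [CompleteSpace E] {B : E →L[ℂ] E}
    (hB : IsSelfAdjoint B) {β : ℂ}
    (hacc : ¬ AccPt β (𝓟 (_root_.spectrum ℂ B)))
    (hfin : FiniteDimensional ℂ (Module.End.eigenspace (B : E →ₗ[ℂ] E) β)) :
    HasLeftParametrix B β := by
  classical
  have hn : IsStarNormal B := hB.isStarNormal
  have hev : ∀ᶠ y in 𝓝 β, y ∈ _root_.spectrum ℂ B → y = β := by
    rw [accPt_iff_frequently, not_frequently] at hacc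
    filter_upwards [hacc] with y hy hyB
    by_contra hne
    exact hy ⟨hne, hyB⟩
  let e : ℂ → ℂ := fun y => if y = β then 1 else 0
  -- At `β` the inverse takes the default value `0`, so `f y * (y - β) = 1 - e y` holds for every
  -- `y`.
  let f : ℂ → ℂ := fun y => (y - β)⁻¹
  -- Near `β` the spectrum contains at most `β` itself, so continuity within the spectrum is
  -- automatic there.
  have hwithin : ∀ g : ℂ → ℂ, (∀ y, y ≠ β → ContinuousAt g y) →
      ContinuousOn g (_root_.spectrum ℂ B) := by
    intro g hg y hy
    rcases eq_or_ne y β with rfl | hne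
    · refine (continuousWithinAt_const (b := g y)).congr_of_eventuallyEq ?_ rfl
      filter_upwards [mem_nhdsWithin_of_mem_nhds hev, self_mem_nhdsWithin] with z hz hzB
      rw [hz hzB]
    · exact (hg y hne).continuousWithinAt
  have he : ContinuousOn e (_root_.spectrum ℂ B) := hwithin e fun y hy => by
    refine (continuousAt_const (y := (0 : ℂ))).congr ?_
    filter_upwards [isOpen_ne.mem_nhds hy] with z hz
    simp only [e, if_neg hz]
  have hf : ContinuousOn f (_root_.spectrum ℂ B) := hwithin f fun y hy =>
    (continuousAt_id.sub continuousAt_const).inv₀ (sub_ne_zero.2 hy)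
  have hlin : ContinuousOn (fun y : ℂ => y - β) (_root_.spectrum ℂ B) := by fun_prop
  have hBβ : cfc (fun y : ℂ => y - β) B = B - algebraMap ℂ _ β := by
    rw [cfc_sub (fun y => y) (fun _ => β) B, cfc_id' ℂ B, cfc_const β B]
  have h1 : cfc f B * (B - algebraMap ℂ _ β) = 1 - cfc e B := by
    rw [← hBβ, ← cfc_mul f _ B, ← cfc_one ℂ B, ← cfc_sub 1 e B]
    refine cfc_congr fun y _ => ?_
    rcases eq_or_ne y β with rfl | hne
    · simp [f, e]
    · simp [f, e, hne, inv_mul_cancel₀ (sub_ne_zero.2 hne)]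
  have h2 : (B - algebraMap ℂ _ β) * cfc e B = 0 := by
    rw [← hBβ, ← cfc_mul _ e B]
    rw [show (fun y => (y - β) * e y) = fun _ => 0 from funext fun y => by
      rcases eq_or_ne y β with rfl | hne <;> simp [e, *]]
    exact cfc_const_zero ℂ B
  have happ : ∀ x, (B - algebraMap ℂ (E →L[ℂ] E) β) x = B x - β • x := fun x => by
    rw [sub_apply, Algebra.algebraMap_eq_smul_one]; rfl
  refine ⟨cfc f B, cfc e B, ?_, fun x => ?_⟩
  · have hmem : ∀ x, cfc e B x ∈ Module.End.eigenspace (B : E →ₗ[ℂ] E) β := fun x => by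
      rw [Module.End.mem_eigenspace_iff]
      have := congrArg (fun A : E →L[ℂ] E => A x) h2
      simp only [mul_apply_eq_comp, happ, zero_apply] at this
      exact sub_eq_zero.1 this
    have := FiniteDimensional.proper ℂ (Module.End.eigenspace (B : E →ₗ[ℂ] E) β)
    exact (isCompactOperator_of_locallyCompactSpace_rng
      (Module.End.eigenspace (B : E →ₗ[ℂ] E) β).subtypeL).comp_clm
        ((cfc e B).codRestrict _ hmem)
  · have := congrArg (fun A : E →L[ℂ] E => A x) h1
    simpa only [mul_apply_eq_comp, happ, sub_apply,
      one_apply_eq_self] using this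

end Parametrix

/-! ### Resolvents of unbounded operators -/

section Resolvent

variable {E : Type*} [NormedAddCommGroup E] [NormedSpace ℂ E] {T : E →ₗ.[ℂ] E} {z w : ℂ}
  {B R : E →L[ℂ] E}

theorem IsResolventAt.mem_domain (h : IsResolventAt T w B) (f : E) : B f ∈ T.domain :=
  (h.1 f).choose

theorem IsResolventAt.apply (h : IsResolventAt T w B) (f : E) :
    T ⟨B f, h.mem_domain f⟩ = f + w • B f :=
  sub_eq_iff_eq_add.1 (h.1 f).choose_spec

theorem IsResolventAt.apply_eq (h : IsResolventAt T w B) (f : T.domain) :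
    (f : E) = B (T f - w • (f : E)) := (h.2 f).symm

theorem IsResolventAt.identity (hB : IsResolventAt T w B) (hR : IsResolventAt T z R) (f : E) :
    R f = B f + (z - w) • B (R f) := by
  have h := hB.apply_eq ⟨R f, hR.mem_domain f⟩
  rw [hR.apply] at h
  rw [← map_smul, ← map_add]
  refine h.trans (congrArg B ?_)
  rw [sub_smul]; abel

theorem IsResolventAt.notMem_spectrum (h : IsResolventAt T w B) : w ∉ spectrum T :=
  fun hw => hw ⟨B, h⟩

theorem isUnit_algebraMap_sub_iff {β : ℂ} : IsUnit (algebraMap ℂ (E →L[ℂ] E) β - B) ↔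
    ∃ C : E →L[ℂ] E, ∀ x, C (β • x - B x) = x ∧ β • C x - B (C x) = x := by
  have happ : ∀ x, (algebraMap ℂ (E →L[ℂ] E) β - B) x = β • x - B x := fun x => by
    rw [sub_apply, Algebra.algebraMap_eq_smul_one]; rfl
  constructor
  · rintro ⟨u, hu⟩
    refine ⟨↑u⁻¹, fun x => ⟨?_, ?_⟩⟩
    · rw [← happ, ← hu, ← mul_apply_eq_comp, u.inv_mul, one_apply_eq_self]
    · rw [← happ, ← hu, ← mul_apply_eq_comp, u.mul_inv, one_apply_eq_self]
  · rintro ⟨C, hC⟩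
    refine ⟨⟨_, C, ContinuousLinearMap.ext fun x => ?_, ContinuousLinearMap.ext fun x => ?_⟩, rfl⟩
    · rw [mul_apply_eq_comp, happ, (hC x).2, one_apply_eq_self]
    · rw [mul_apply_eq_comp, happ, (hC x).1, one_apply_eq_self]

/-- On the range of `B` one has `(T - z) B = (z - w) ((z - w)⁻¹ - B)`, so each side is inverted by
means of the other. -/
theorem IsResolventAt.mem_spectrum_iff (hB : IsResolventAt T w B) (hz : z ≠ w) :
    z ∈ spectrum T ↔ (z - w)⁻¹ ∈ _root_.spectrum ℂ B := by
  have hzw : z - w ≠ 0 := sub_ne_zero.2 hz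
  rw [spectrum.mem_iff, isUnit_algebraMap_sub_iff]
  refine not_congr ⟨?_, ?_⟩
  · rintro ⟨R, hR⟩
    have h1 := hB.identity hR
    have h2 := hR.identity hB
    refine ⟨(z - w) • (1 + (z - w) • R), fun x => ?_⟩
    have e2 : (z - w) • R (B x) = R x - B x := by
      nth_rewrite 2 [h2 x]
      rw [← neg_sub z w, neg_smul]; abel
    have e3 : (z - w) • B (R x) = R x - B x := by
      nth_rewrite 2 [h1 x]
      abel
    simp only [smul_apply, add_apply, one_apply_eq_self, map_smul, map_sub, map_add]
    rw [inv_smul_smul₀ hzw, e2, e3, add_sub_cancel, add_sub_cancel_right]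
    exact ⟨rfl, rfl⟩
  · rintro ⟨C, hC⟩
    have key : ∀ g, T ⟨B g, hB.mem_domain g⟩ - z • B g = (z - w) • ((z - w)⁻¹ • g - B g) := by
      intro g
      rw [hB.apply, smul_sub, smul_inv_smul₀ hzw, sub_smul]; abel
    refine ⟨(z - w)⁻¹ • B.comp C, fun f => ?_, fun f => ?_⟩
    · have hm : ((z - w)⁻¹ • B.comp C) f = B ((z - w)⁻¹ • C f) := by simp
      simp only [hm]
      refine ⟨hB.mem_domain _, ?_⟩
      rw [key, smul_sub, smul_inv_smul₀ hzw, map_smul, smul_inv_smul₀ hzw, (hC f).2]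
    · obtain ⟨f, hf⟩ := f
      have hf' := hB.apply_eq ⟨f, hf⟩
      set g := T ⟨f, hf⟩ - w • f with hg
      simp only at hf'
      have e : T ⟨f, hf⟩ - z • f = (z - w) • ((z - w)⁻¹ • g - B g) := by
        rw [← hf', smul_sub, smul_inv_smul₀ hzw, hg, sub_smul]; abel
      simp only [e, smul_apply, ContinuousLinearMap.comp_apply, map_smul]
      rw [smul_inv_smul₀ hzw, (hC g).1]
      exact hf'.symm

theorem IsResolventAt.domain_le {V : E →ₗ.[ℂ] E} (hB : IsResolventAt T w B)
    (hK : ∀ f, B f ∈ V.domain) : T.domain ≤ V.domain := by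
  intro f hf
  have := hB.apply_eq ⟨f, hf⟩
  simp only at this
  rw [this]
  exact hK _

theorem mem_eigenspace_iff {f : E} :
    f ∈ eigenspace T z ↔ ∃ h : f ∈ T.domain, T ⟨f, h⟩ = z • f := by
  simp only [eigenspace, Submodule.mem_map, LinearMap.mem_ker, Submodule.subtype_apply,
    LinearMap.sub_apply, LinearMap.smul_apply, sub_eq_zero]
  constructor
  · rintro ⟨x, hx, rfl⟩
    exact ⟨x.2, hx⟩
  · rintro ⟨h, hf⟩
    exact ⟨⟨f, h⟩, hf, rfl⟩

theorem IsResolventAt.eigenspace_eq (hB : IsResolventAt T w B) (hz : z ≠ w) :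
    eigenspace T z = Module.End.eigenspace (B : E →ₗ[ℂ] E) (z - w)⁻¹ := by
  have hzw : z - w ≠ 0 := sub_ne_zero.2 hz
  ext f
  rw [mem_eigenspace_iff, Module.End.mem_eigenspace_iff, ContinuousLinearMap.coe_coe]
  constructor
  · rintro ⟨h, hf⟩
    have := hB.apply_eq ⟨f, h⟩
    rw [hf, ← sub_smul, map_smul] at this
    rw [eq_inv_smul_iff₀ hzw]
    exact this.symm
  · intro h
    have hf : f = B ((z - w) • f) := by rw [map_smul, h, smul_inv_smul₀ hzw]
    have hd : f ∈ T.domain := hf ▸ hB.mem_domain _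
    refine ⟨hd, ?_⟩
    have : T ⟨f, hd⟩ = (z - w) • f + w • B ((z - w) • f) := by
      rw [← hB.apply]
      congr 1
      exact Subtype.ext hf
    rw [this, ← hf, sub_smul]; abel

/-- The map `y ↦ (y - w)⁻¹` is a local homeomorphism away from `w` and matches the two spectra. -/
theorem IsResolventAt.accPt_iff (hB : IsResolventAt T w B) (hz : z ≠ w) :
    AccPt z (𝓟 (spectrum T)) ↔ AccPt (z - w)⁻¹ (𝓟 (_root_.spectrum ℂ B)) := by
  have hzw : z - w ≠ 0 := sub_ne_zero.2 hz
  rw [accPt_iff_frequently, accPt_iff_frequently]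
  constructor
  · intro h
    have hc : Tendsto (fun y : ℂ => (y - w)⁻¹) (𝓝 z) (𝓝 (z - w)⁻¹) :=
      ((continuousAt_id.sub continuousAt_const).inv₀ hzw)
    refine hc.frequently (h.mono ?_)
    rintro y ⟨hne, hy⟩
    have hyw : y ≠ w := fun e => hB.notMem_spectrum (e ▸ hy)
    refine ⟨fun e => hne ?_, (hB.mem_spectrum_iff hyw).1 hy⟩
    exact sub_left_injective (inv_injective e)
  · intro h
    have hc : Tendsto (fun y : ℂ => y⁻¹ + w) (𝓝 (z - w)⁻¹) (𝓝 ((z - w)⁻¹⁻¹ + w)) :=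
      ((continuousAt_inv₀ (inv_ne_zero hzw)).add continuousAt_const)
    rw [inv_inv, sub_add_cancel] at hc
    have h0 : ∀ᶠ y : ℂ in 𝓝 (z - w)⁻¹, y ≠ 0 := isOpen_ne.mem_nhds (inv_ne_zero hzw)
    refine hc.frequently ((h.and_eventually h0).mono ?_)
    rintro y ⟨⟨hne, hy⟩, hy0⟩
    refine ⟨fun e => hne ?_, (hB.mem_spectrum_iff (by simpa using hy0)).2 (by simpa using hy)⟩
    rw [← e, add_sub_cancel_right, inv_inv]

end Resolvent

/-! ### Symmetric operators with a real resolvent point, and Weyl's theorem -/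

section SelfAdjoint

theorem isFormalAdjoint_add {E : Type*} [NormedAddCommGroup E] [InnerProductSpace ℂ E]
    {T V : E →ₗ.[ℂ] E} (hT : T.IsFormalAdjoint T) (hV : V.IsFormalAdjoint V) :
    (T + V).IsFormalAdjoint (T + V) := by
  rintro ⟨f, hf⟩ ⟨g, hg⟩
  rw [LinearPMap.add_apply, LinearPMap.add_apply, inner_add_left, inner_add_right]
  exact congrArg₂ _ (hT ⟨f, hf.1⟩ ⟨g, hg.1⟩) (hV ⟨f, hf.2⟩ ⟨g, hg.2⟩)

variable {E : Type*} [NormedAddCommGroup E] [InnerProductSpace ℂ E] [CompleteSpace E]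
  {T : E →ₗ.[ℂ] E} {c : ℝ} {B : E →L[ℂ] E}

theorem IsResolventAt.isSelfAdjoint (hB : IsResolventAt T c B)
    (hT : T.IsFormalAdjoint T) : IsSelfAdjoint B := by
  rw [ContinuousLinearMap.isSelfAdjoint_iff_isSymmetric]
  intro f g
  have h := hT ⟨B f, hB.mem_domain f⟩ ⟨B g, hB.mem_domain g⟩
  rw [hB.apply, hB.apply, inner_add_left, inner_add_right, inner_smul_left, inner_smul_right,
    Complex.conj_ofReal] at h
  exact (add_right_cancel h).symm

/-- The domain contains the range of the self-adjoint `B`; a vector orthogonal to it lies in the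
kernel of `B`, which is trivial. -/
theorem IsResolventAt.dense_domain (hB : IsResolventAt T c B)
    (hT : T.IsFormalAdjoint T) : Dense (T.domain : Set E) := by
  rw [Submodule.dense_iff_topologicalClosure_eq_top, Submodule.topologicalClosure_eq_top_iff,
    Submodule.eq_bot_iff]
  intro g hg
  have h0 : B g = 0 := by
    refine ext_inner_left ℂ fun f => ?_
    have h1 := (hB.isSelfAdjoint hT).isSymmetric f g
    simp only [ContinuousLinearMap.coe_coe] at h1
    rw [← h1, inner_zero_right]
    exact hg _ (hB.mem_domain f)
  have := hB.apply g
  have h2 : T ⟨B g, hB.mem_domain g⟩ = 0 := by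
    rw [← T.map_zero]
    congr 1
    exact Subtype.ext h0
  rw [h2, h0, smul_zero, add_zero] at this
  exact this.symm

/-- For `y` in the adjoint domain and `v = (T* - c) y`, the vector `y - B v` is orthogonal to the
range of `T - c`, which is the whole space. Hence `y = B v` lies in the domain of `T`. -/
theorem IsResolventAt.isSelfAdjoint_pmap (hB : IsResolventAt T c B)
    (hT : T.IsFormalAdjoint T) : IsSelfAdjoint T := by
  have hd := hB.dense_domain hT
  rw [LinearPMap.isSelfAdjoint_def]
  have hle : T ≤ T.adjoint := hT.le_adjoint hd
  refine (LinearPMap.eq_of_le_of_domain_eq hle (le_antisymm hle.1 ?_)).symm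
  intro y hy
  set v := T.adjoint ⟨y, hy⟩ - (c : ℂ) • y with hv
  have h0 : y - B v = 0 := by
    have key : ∀ x : T.domain, inner ℂ (y - B v) (T x - (c : ℂ) • (x : E)) = 0 := by
      intro x
      have h1 : inner ℂ (T.adjoint ⟨y, hy⟩) (x : E) = inner ℂ y (T x) :=
        (LinearPMap.adjoint_isFormalAdjoint hd) ⟨y, hy⟩ x
      have h2 : inner ℂ (T ⟨B v, hB.mem_domain v⟩) (x : E) = inner ℂ (B v) (T x) :=
        hT ⟨B v, hB.mem_domain v⟩ x
      rw [hB.apply] at h2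
      rw [inner_sub_left, inner_sub_right, inner_sub_right, ← h1, ← h2, inner_smul_right,
        inner_smul_right, inner_add_left, inner_smul_left, Complex.conj_ofReal, hv,
        inner_sub_left, inner_smul_left, Complex.conj_ofReal]
      ring
    have := key ⟨B (y - B v), hB.mem_domain _⟩
    rw [hB.apply, add_sub_cancel_right] at this
    exact inner_self_eq_zero.1 this
  rw [sub_eq_zero.1 h0]
  exact hB.mem_domain v

/-- A symmetric operator whose resolvent set contains a left half-line is bounded from below. -/
theorem le_re_inner_of_isResolventAt (hT : T.IsFormalAdjoint T)
    (h : ∀ a : ℝ, a ≤ c → ∃ R : E →L[ℂ] E, IsResolventAt T a R) (f : T.domain) :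
    c * ‖(f : E)‖ ^ 2 ≤ (inner ℂ (f : E) (T f)).re := by
  obtain ⟨B, hB⟩ := h c le_rfl
  have hsa := hB.isSelfAdjoint hT
  have hpos : 0 ≤ B := by
    rw [StarOrderedRing.nonneg_iff_spectrum_nonneg (R := ℝ) B hsa]
    intro x hx
    rw [← spectrum.algebraMap_mem_iff ℂ, Complex.coe_algebraMap] at hx
    by_contra! hlt
    have hne : (x : ℂ) ≠ 0 := by exact_mod_cast hlt.ne
    -- A negative point `x` of the spectrum of `B` would put `c + x⁻¹ < c` into the spectrum of `T`.
    -- So `B ≥ 0`, and testing this on `(T - c) f` gives the bound.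
    obtain ⟨R, hR⟩ := h (c + x⁻¹) (by linarith [inv_lt_zero.2 hlt])
    refine hR.notMem_spectrum ((hB.mem_spectrum_iff ?_).2 ?_)
    · push_cast
      simpa using hne
    · simpa using hx
  rw [ContinuousLinearMap.nonneg_iff_isPositive] at hpos
  have h1 := hpos.2 (T f - (c : ℂ) • (f : E))
  have hr : (inner ℂ (B (T f - (c : ℂ) • (f : E))) (T f - (c : ℂ) • (f : E))).re =
      (inner ℂ (f : E) (T f)).re - c * ‖(f : E)‖ ^ 2 := by
    rw [← hB.apply_eq f, inner_sub_right, inner_smul_right, inner_self_eq_norm_sq_to_K]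
    simp [← Complex.ofReal_pow]
  change 0 ≤ (inner ℂ (B (T f - (c : ℂ) • (f : E))) (T f - (c : ℂ) • (f : E))).re at h1
  linarith

/-- This form of the essential spectrum mentions only `B` modulo compact operators. -/
theorem IsResolventAt.mem_essentialSpectrum_iff (hB : IsResolventAt T c B)
    (hT : T.IsFormalAdjoint T) {z : ℂ} :
    z ∈ essentialSpectrum T ↔ z ≠ c ∧ ¬ HasLeftParametrix B (z - c)⁻¹ := by
  have hsa := hB.isSelfAdjoint hT
  rcases eq_or_ne z c with rfl | hz
  · simp [essentialSpectrum, hB.notMem_spectrum]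
  have hspec := hB.mem_spectrum_iff hz
  simp only [essentialSpectrum, discreteSpectrum, Set.mem_sdiff, Set.mem_ofPred_eq, hspec,
    hB.accPt_iff hz]
  rw [hB.eigenspace_eq hz]
  constructor
  · rintro ⟨h1, h2⟩
    exact ⟨hz, fun hP => h2 ⟨h1, hP.not_accPt hsa, hP.exists_eigenvector hsa h1,
      hP.finiteDimensional_eigenspace⟩⟩
  · rintro ⟨-, h⟩
    refine ⟨?_, fun h2 => h (HasLeftParametrix.of_not_accPt hsa h2.2.1 h2.2.2.2)⟩
    by_contra h1
    rw [spectrum.notMem_iff, isUnit_algebraMap_sub_iff] at h1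
    obtain ⟨C, hC⟩ := h1
    refine h ⟨-C, 0, isCompactOperator_zero, fun x => ?_⟩
    rw [neg_apply, ← map_neg, neg_sub, (hC x).1, zero_apply, sub_zero]

/-- Weyl's theorem: a compact resolvent difference preserves the essential spectrum. -/
theorem essentialSpectrum_eq_of_isCompactOperator_sub {S : E →ₗ.[ℂ] E} {A : E →L[ℂ] E}
    (hT : T.IsFormalAdjoint T) (hS : S.IsFormalAdjoint S) (hB : IsResolventAt T c B)
    (hA : IsResolventAt S c A) (hc : IsCompactOperator (A - B)) :
    essentialSpectrum S = essentialSpectrum T := by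
  ext z
  rw [hA.mem_essentialSpectrum_iff hS, hB.mem_essentialSpectrum_iff hT]
  refine and_congr_right fun _ => not_congr ⟨fun h => h.of_isCompactOperator_sub ?_,
    fun h => h.of_isCompactOperator_sub hc⟩
  rw [← neg_sub A B]
  exact hc.neg

end SelfAdjoint

/-! ### Relatively small perturbations of a resolvent -/

section Perturbation

variable {E : Type*} [NormedAddCommGroup E] [NormedSpace ℂ E] [CompleteSpace E]
  {T V : E →ₗ.[ℂ] E} {z : ℂ} {R K : E →L[ℂ] E}

/-- On the domain of `T + V` one has `T + V - z = (1 + K)(T - z)`. The witness `L` is the Neumann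
inverse of `1 + K`, and `L = 1 - K L` gives the difference formula, which inherits compactness from
`K`. -/
theorem IsResolventAt.exists_add (hR : IsResolventAt T z R)
    (hK : ∀ f, ∃ h : R f ∈ V.domain, V ⟨R f, h⟩ = K f) (hlt : ‖K‖ < 1) :
    ∃ B L : E →L[ℂ] E, IsResolventAt (T + V) z B ∧ B - R = -(R ∘L K ∘L L) := by
  have hu : IsUnit (1 + K) := by
    have := isUnit_one_sub_of_norm_lt_one (x := -K) (by rwa [norm_neg])
    rwa [sub_neg_eq_add] at this
  obtain ⟨u, hu⟩ := hu
  set L : E →L[ℂ] E := ↑u⁻¹ with hL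
  have h1 : ∀ x, L x + K (L x) = x := fun x => by
    have := congrArg (fun A : E →L[ℂ] E => A x) u.mul_inv
    simpa [hu, mul_apply_eq_comp] using this
  have h2 : ∀ x, L (x + K x) = x := fun x => by
    have := congrArg (fun A : E →L[ℂ] E => A x) u.inv_mul
    simpa [hu, mul_apply_eq_comp] using this
  refine ⟨R ∘L L, L, ⟨fun f => ?_, fun f => ?_⟩, ?_⟩
  · refine ⟨⟨hR.mem_domain _, (hK _).choose⟩, ?_⟩
    rw [LinearPMap.add_apply]
    change T ⟨R (L f), hR.mem_domain _⟩ + V ⟨R (L f), (hK _).choose⟩ - z • R (L f) = f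
    rw [(hK _).choose_spec, hR.apply]
    calc L f + z • R (L f) + K (L f) - z • R (L f) = L f + K (L f) := by abel
      _ = f := h1 f
  · obtain ⟨f, hf⟩ := f
    have e := hR.apply_eq ⟨f, hf.1⟩
    set g := T ⟨f, hf.1⟩ - z • f with hg
    simp only at e
    have e2 : V ⟨f, hf.2⟩ = K g := by
      rw [← (hK g).choose_spec]
      congr 1
      exact Subtype.ext e
    rw [LinearPMap.add_apply]
    change R (L (T ⟨f, hf.1⟩ + V ⟨f, hf.2⟩ - z • f)) = f
    rw [e2, add_sub_right_comm, ← hg, h2]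
    exact e.symm
  · ext x
    simp only [sub_apply, neg_apply, ContinuousLinearMap.comp_apply]
    nth_rewrite 2 [← h1 x]
    rw [map_add]; abel

end Perturbation

/-! ### Semigroups of symmetric contractions and their resolvents -/

section Generator

variable {E : Type*} [NormedAddCommGroup E] [InnerProductSpace ℂ E]

/-- Strongly continuous semigroups of symmetric contractions. -/
structure IsSymmetricSemigroup (P : ℝ → E →L[ℂ] E) : Prop where
  zero : P 0 = 1
  add : ∀ s t : ℝ, 0 < s → 0 < t → ∀ f, P (s + t) f = P s (P t f)
  norm_le : ∀ t f, ‖P t f‖ ≤ ‖f‖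
  symm : ∀ t f g, inner ℂ (P t f) g = inner ℂ f (P t g)
  tendsto : ∀ f, Tendsto (fun t => P t f) (𝓝[>] 0) (𝓝 f)

theorem mem_generator_domain {P : ℝ → E →L[ℂ] E} {f g : E}
    (h : Tendsto (fun t : ℝ => (t : ℂ)⁻¹ • (f - P t f)) (𝓝[>] 0) (𝓝 g)) :
    f ∈ (generator P).domain := ⟨g, h⟩

theorem tendsto_generator {P : ℝ → E →L[ℂ] E} (f : (generator P).domain) :
    Tendsto (fun t : ℝ => (t : ℂ)⁻¹ • ((f : E) - P t f)) (𝓝[>] 0) (𝓝 (generator P f)) :=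
  f.2.choose_spec

theorem generator_apply_eq {P : ℝ → E →L[ℂ] E} {f g : E}
    (h : Tendsto (fun t : ℝ => (t : ℂ)⁻¹ • (f - P t f)) (𝓝[>] 0) (𝓝 g)) :
    generator P ⟨f, mem_generator_domain h⟩ = g :=
  tendsto_nhds_unique (tendsto_generator ⟨f, mem_generator_domain h⟩) h

variable {P : ℝ → E →L[ℂ] E}

theorem IsSymmetricSemigroup.isFormalAdjoint_generator (hP : IsSymmetricSemigroup P) :
    (generator P).IsFormalAdjoint (generator P) := by
  intro f g
  have h1 := (tendsto_generator f).inner (tendsto_const_nhds (x := (g : E))) (𝕜 := ℂ)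
  have h2 := (tendsto_const_nhds (x := (f : E))).inner (tendsto_generator g) (𝕜 := ℂ)
  refine tendsto_nhds_unique h1 (h2.congr fun t => ?_)
  rw [inner_smul_left, inner_smul_right, inner_sub_left, inner_sub_right, hP.symm, map_inv₀,
    Complex.conj_ofReal]

theorem IsSymmetricSemigroup.re_inner_generator_nonneg (hP : IsSymmetricSemigroup P)
    (f : (generator P).domain) :
    0 ≤ (inner ℂ (f : E) (generator P f)).re := by
  have h2 := (tendsto_const_nhds (x := (f : E))).inner (tendsto_generator f) (𝕜 := ℂ)
  refine ge_of_tendsto ((Complex.continuous_re.tendsto _).comp h2) ?_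
  filter_upwards [self_mem_nhdsWithin] with t ht
  have ht : 0 < t := ht
  rw [Function.comp_apply, inner_smul_right, ← Complex.ofReal_inv, Complex.re_ofReal_mul,
    inner_sub_right, Complex.sub_re]
  refine mul_nonneg (inv_nonneg.2 ht.le) (sub_nonneg.2 ?_)
  calc (inner ℂ (f : E) (P t f)).re ≤ ‖(f : E)‖ * ‖P t f‖ := re_inner_le_norm (𝕜 := ℂ) _ _
    _ ≤ ‖(f : E)‖ * ‖(f : E)‖ := mul_le_mul_of_nonneg_left (hP.norm_le t f) (norm_nonneg _)
    _ = (inner ℂ (f : E) (f : E)).re := (inner_self_eq_norm_mul_norm (𝕜 := ℂ) (f : E)).symm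

/-- The semigroup law and contractivity give `‖P t f - P s f‖ ≤ ‖P (t - s) f - f‖` for `0 < s ≤ t`,
reducing continuity to time zero. -/
theorem IsSymmetricSemigroup.continuousOn (hP : IsSymmetricSemigroup P) (f : E) :
    ContinuousOn (fun t => P t f) (Set.Ioi 0) := by
  have hω : Tendsto (fun h => ‖P h f - f‖) (𝓝[≥] 0) (𝓝 0) := by
    have h0 : Tendsto (fun h => P h f) (𝓝[≥] 0) (𝓝 f) := by
      rw [← Set.Ioi_insert, nhdsWithin_insert, tendsto_sup]
      refine ⟨?_, hP.tendsto f⟩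
      have := tendsto_pure_nhds (fun h => P h f) (0 : ℝ)
      rwa [hP.zero] at this
    simpa using (h0.sub_const f).norm
  have key : ∀ s t : ℝ, 0 < s → s ≤ t → ‖P t f - P s f‖ ≤ ‖P (t - s) f - f‖ := by
    intro s t hs hst
    rcases hst.eq_or_lt with rfl | hlt
    · simp
    have : P t f = P s (P (t - s) f) := by
      rw [← hP.add s (t - s) hs (sub_pos.2 hlt), add_sub_cancel]
    rw [this, ← map_sub]
    exact hP.norm_le s _
  intro t ht
  have ht : 0 < t := ht
  rw [ContinuousWithinAt, tendsto_iff_norm_sub_tendsto_zero]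
  have hlim : Tendsto (fun s => |s - t|) (𝓝[Set.Ioi 0] t) (𝓝[≥] 0) := by
    refine tendsto_nhdsWithin_iff.2 ⟨?_, Eventually.of_forall fun s => Set.mem_Ici.2 (abs_nonneg _)⟩
    have : Tendsto (fun s => |s - t|) (𝓝 t) (𝓝 |t - t|) :=
      (continuous_abs.comp (continuous_id.sub continuous_const)).tendsto t
    rw [sub_self, abs_zero] at this
    exact this.mono_left nhdsWithin_le_nhds
  refine squeeze_zero' (Eventually.of_forall fun s => norm_nonneg _) ?_ (hω.comp hlim)
  filter_upwards [self_mem_nhdsWithin] with s hs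
  have hs : 0 < s := hs
  rw [Function.comp_apply]
  rcases le_total s t with h | h
  · rw [norm_sub_rev, abs_sub_comm, abs_of_nonneg (sub_nonneg.2 h)]
    exact key s t hs h
  · rw [abs_of_nonneg (sub_nonneg.2 h)]
    exact key t s ht h

theorem IsSymmetricSemigroup.integrableOn (hP : IsSymmetricSemigroup P) {a : ℝ} (ha : 0 < a)
    (f : E) :
    IntegrableOn (fun t => (Real.exp (-a * t) : ℂ) • P t f) (Set.Ioi 0) := by
  refine Integrable.mono' ((exp_neg_integrableOn_Ioi 0 ha).mul_const ‖f‖) ?_ ?_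
  · refine ContinuousOn.aestronglyMeasurable ?_ measurableSet_Ioi
    exact ContinuousOn.smul (by fun_prop) (hP.continuousOn f)
  · refine Eventually.of_forall fun t => ?_
    rw [norm_smul, Complex.norm_real, Real.norm_of_nonneg (Real.exp_pos _).le]
    exact mul_le_mul_of_nonneg_left (hP.norm_le t f) (Real.exp_pos _).le

theorem IsSymmetricSemigroup.norm_integral_le (hP : IsSymmetricSemigroup P) {a : ℝ} (ha : 0 < a)
    (f : E) :
    ‖∫ t in Set.Ioi (0 : ℝ), (Real.exp (-a * t) : ℂ) • P t f‖ ≤ a⁻¹ * ‖f‖ := by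
  refine (norm_integral_le_of_norm_le ((exp_neg_integrableOn_Ioi 0 ha).mul_const ‖f‖)
    (Eventually.of_forall fun t => ?_)).trans (le_of_eq ?_)
  · rw [norm_smul, Complex.norm_real, Real.norm_of_nonneg (Real.exp_pos _).le]
    exact mul_le_mul_of_nonneg_left (hP.norm_le t f) (Real.exp_pos _).le
  · rw [integral_mul_const, integral_exp_mul_Ioi (neg_lt_zero.2 ha)]
    simp [neg_div_neg_eq]

/-- The Laplace transform `∫₀^∞ e^{-at} P_t dt` of a semigroup. -/
noncomputable def laplaceTransform (hP : IsSymmetricSemigroup P) {a : ℝ} (ha : 0 < a) : E →L[ℂ] E :=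
  LinearMap.mkContinuous
    { toFun := fun f => ∫ t in Set.Ioi (0 : ℝ), (Real.exp (-a * t) : ℂ) • P t f
      map_add' := fun f g => by
        rw [← integral_add (hP.integrableOn ha f) (hP.integrableOn ha g)]
        simp only [map_add, smul_add]
      map_smul' := fun c f => by
        rw [RingHom.id_apply, ← integral_smul]
        simp only [map_smul, smul_comm c] }
    a⁻¹ (hP.norm_integral_le ha)

theorem laplaceTransform_apply (hP : IsSymmetricSemigroup P) {a : ℝ} (ha : 0 < a) (f : E) :
    laplaceTransform hP ha f = ∫ t in Set.Ioi (0 : ℝ), (Real.exp (-a * t) : ℂ) • P t f := rfl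

theorem norm_laplaceTransform_apply_le (hP : IsSymmetricSemigroup P) {a : ℝ} (ha : 0 < a) (f : E) :
    ‖laplaceTransform hP ha f‖ ≤ a⁻¹ * ‖f‖ := hP.norm_integral_le ha f

variable [CompleteSpace E]

/-- A bounded `M` moves under the Bochner integral; unbounded multipliers are reached later by
truncation. -/
theorem norm_map_laplaceTransform_le (hP : IsSymmetricSemigroup P) {a : ℝ} (ha : 0 < a)
    (M : E →L[ℂ] E) (f : E) {φ : ℝ → ℝ}
    (hφ : IntegrableOn (fun t => Real.exp (-a * t) * φ t) (Set.Ioi 0))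
    (hM : ∀ t, 0 < t → ‖M (P t f)‖ ≤ φ t) :
    ‖M (laplaceTransform hP ha f)‖ ≤ ∫ t in Set.Ioi (0 : ℝ), Real.exp (-a * t) * φ t := by
  rw [laplaceTransform_apply, ← ContinuousLinearMap.integral_comp_comm M (hP.integrableOn ha f)]
  refine norm_integral_le_of_norm_le hφ ?_
  refine (ae_restrict_iff' measurableSet_Ioi).2 (Eventually.of_forall fun t ht => ?_)
  rw [map_smul, norm_smul, Complex.norm_real, Real.norm_of_nonneg (Real.exp_pos _).le]
  exact mul_le_mul_of_nonneg_left (hM t ht) (Real.exp_pos _).le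

/-- Applying `e^{-as} P s` shifts the integration to `(s, ∞)`. The remaining integral over `(0, s]`
serves twice: divided by `s` it identifies the generator, and its norm is at most `s ‖f‖`. -/
theorem laplaceTransform_sub (hP : IsSymmetricSemigroup P) {a s : ℝ} (ha : 0 < a) (hs : 0 < s)
    (f : E) :
    laplaceTransform hP ha f - (Real.exp (-a * s) : ℂ) • P s (laplaceTransform hP ha f) =
      ∫ t in Set.Ioc 0 s, (Real.exp (-a * t) : ℂ) • P t f := by
  have h1 : (Real.exp (-a * s) : ℂ) • P s (laplaceTransform hP ha f) =
      ∫ t in Set.Ioi s, (Real.exp (-a * t) : ℂ) • P t f := by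
    rw [laplaceTransform_apply,
      ← ContinuousLinearMap.integral_comp_comm (P s) (hP.integrableOn ha f), ← integral_smul,
      ← (measurePreserving_add_right volume s).setIntegral_preimage_emb
        (measurableEmbedding_addRight s) _ (Set.Ioi s)]
    have hpre : (fun x => x + s) ⁻¹' Set.Ioi s = Set.Ioi 0 := by simp
    rw [hpre]
    refine setIntegral_congr_fun measurableSet_Ioi fun t ht => ?_
    rw [map_smul, smul_smul, add_comm t s, hP.add s t hs ht, ← Complex.ofReal_mul, ← Real.exp_add]
    ring_nf
  rw [h1, laplaceTransform_apply, ← Set.Ioc_union_Ioi_eq_Ioi hs.le,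
    setIntegral_union Set.Ioc_disjoint_Ioi_same measurableSet_Ioi
      ((hP.integrableOn ha f).mono_set Set.Ioc_subset_Ioi_self)
      ((hP.integrableOn ha f).mono_set (Set.Ioi_subset_Ioi hs.le)), add_sub_cancel_right]

theorem norm_laplaceTransform_sub_le (hP : IsSymmetricSemigroup P) {a s : ℝ} (ha : 0 < a)
    (hs : 0 < s) (f : E) :
    ‖laplaceTransform hP ha f - (Real.exp (-a * s) : ℂ) • P s (laplaceTransform hP ha f)‖ ≤
      s * ‖f‖ := by
  rw [laplaceTransform_sub hP ha hs]
  refine (norm_setIntegral_le_of_norm_le_const (C := ‖f‖) (by simp) fun t ht => ?_).trans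
    (le_of_eq ?_)
  · rw [norm_smul, Complex.norm_real, Real.norm_of_nonneg (Real.exp_pos _).le]
    refine (mul_le_mul (Real.exp_le_one_iff.2 ?_) (hP.norm_le t f) (norm_nonneg _)
      zero_le_one).trans_eq (one_mul _)
    nlinarith [mul_pos ha ht.1]
  · simp [hs.le, mul_comm]

theorem tendsto_average (hP : IsSymmetricSemigroup P) {a : ℝ} (ha : 0 < a) (f : E) :
    Tendsto (fun s : ℝ => (s : ℂ)⁻¹ • ∫ t in Set.Ioc 0 s, (Real.exp (-a * t) : ℂ) • P t f)
      (𝓝[>] 0) (𝓝 f) := by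
  have hlim : Tendsto (fun t : ℝ => (Real.exp (-a * t) : ℂ) • P t f) (𝓝[>] 0) (𝓝 f) := by
    have h1 : Tendsto (fun t : ℝ => (Real.exp (-a * t) : ℂ)) (𝓝 0) (𝓝 (Real.exp (-a * 0) : ℂ)) :=
      Continuous.tendsto (by fun_prop) 0
    have := (h1.mono_left nhdsWithin_le_nhds).smul (hP.tendsto f)
    simpa using this
  rw [Metric.tendsto_nhds] at hlim ⊢
  intro ε hε
  obtain ⟨δ, hδ, hball⟩ := (mem_nhdsGT_iff_exists_Ioo_subset (a := (0 : ℝ))).1 (hlim (ε / 2)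
    (half_pos hε))
  filter_upwards [Ioo_mem_nhdsGT (show (0 : ℝ) < δ from hδ)] with s hs
  have hs0 : (s : ℂ) ≠ 0 := by exact_mod_cast hs.1.ne'
  have hf : f = (s : ℂ)⁻¹ • ∫ _ in Set.Ioc 0 s, f := by
    rw [setIntegral_const]
    simp only [Real.volume_real_Ioc, sub_zero, max_eq_left hs.1.le]
    rw [← Complex.coe_smul, inv_smul_smul₀ hs0]
  have hintg : IntegrableOn (fun t => (Real.exp (-a * t) : ℂ) • P t f) (Set.Ioc 0 s) :=
    (hP.integrableOn ha f).mono_set Set.Ioc_subset_Ioi_self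
  rw [dist_eq_norm]
  nth_rewrite 2 [hf]
  rw [← smul_sub, ← integral_sub hintg (integrableOn_const (by simp)), norm_smul, norm_inv,
    Complex.norm_real, Real.norm_of_nonneg hs.1.le, inv_mul_lt_iff₀ hs.1]
  refine (norm_setIntegral_le_of_norm_le_const (C := ε / 2) (by simp) fun t ht => ?_).trans_lt ?_
  · have := hball ⟨ht.1, ht.2.trans_lt hs.2⟩
    simp only [Set.mem_ofPred_eq, dist_eq_norm] at this
    exact this.le
  · simp only [Real.volume_real_Ioc, sub_zero, max_eq_left hs.1.le]
    nlinarith [hs.1]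

/-- With `u` the transform of `f`, `u - P s u = e^{as} (u - e^{-as} P s u) + (1 - e^{as}) u`;
dividing by `s` gives the limit `f - a u`. For the left inverse, the error `w` satisfies `H w = -a
w`, and `H ≥ 0` forces `w = 0`. -/
theorem isResolventAt_laplaceTransform (hP : IsSymmetricSemigroup P) {a : ℝ} (ha : 0 < a) :
    IsResolventAt (generator P) (-(a : ℂ)) (laplaceTransform hP ha) := by
  have hlim : ∀ f, Tendsto (fun s : ℝ => (s : ℂ)⁻¹ • (laplaceTransform hP ha f -
      P s (laplaceTransform hP ha f))) (𝓝[>] 0)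
      (𝓝 (f + (-(a : ℂ)) • laplaceTransform hP ha f)) := by
    intro f
    set u := laplaceTransform hP ha f with hu
    have hexp : Tendsto (fun s : ℝ => ((Real.exp (a * s) : ℝ) : ℂ)) (𝓝[>] 0) (𝓝 1) := by
      have : Tendsto (fun s : ℝ => ((Real.exp (a * s) : ℝ) : ℂ)) (𝓝 0)
        (𝓝 ((Real.exp (a * 0) : ℝ) : ℂ)) := Continuous.tendsto (by fun_prop) 0
      simpa using this.mono_left nhdsWithin_le_nhds
    have hder : Tendsto (fun s : ℝ => ((s⁻¹ * (1 - Real.exp (a * s)) : ℝ) : ℂ)) (𝓝[>] 0)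
        (𝓝 ((-a : ℝ) : ℂ)) := by
      refine (Complex.continuous_ofReal.tendsto _).comp ?_
      have h1 : HasDerivAt (fun s : ℝ => Real.exp (a * s)) a 0 := by
        simpa using ((hasDerivAt_id (0 : ℝ)).const_mul a).exp
      have h2 := h1.tendsto_slope_zero_right
      refine h2.neg.congr fun s => ?_
      simp only [smul_eq_mul, zero_add, mul_zero, Real.exp_zero]
      ring
    have h := (hexp.smul (tendsto_average hP ha f)).add (hder.smul (tendsto_const_nhds (x := u)))
    rw [one_smul, Complex.ofReal_neg] at h
    refine h.congr' ?_
    filter_upwards [self_mem_nhdsWithin] with s hs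
    have hs : 0 < s := hs
    rw [← laplaceTransform_sub hP ha hs, ← hu, smul_comm, smul_sub, smul_smul,
      ← Complex.ofReal_mul, ← Real.exp_add, Complex.ofReal_mul, mul_smul,
      Complex.ofReal_inv, ← smul_add, Complex.ofReal_sub, sub_smul]
    simp
  have hres : ∀ f, ∃ h : laplaceTransform hP ha f ∈ (generator P).domain,
      generator P ⟨laplaceTransform hP ha f, h⟩ - (-(a : ℂ)) • laplaceTransform hP ha f = f :=
    fun f => ⟨mem_generator_domain (hlim f), by
      rw [generator_apply_eq (hlim f), add_sub_cancel_right]⟩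
  refine ⟨hres, fun f => ?_⟩
  obtain ⟨h1, h2⟩ := hres (generator P f - (-(a : ℂ)) • (f : E))
  set v := laplaceTransform hP ha (generator P f - (-(a : ℂ)) • (f : E)) with hv
  set w : (generator P).domain := ⟨v, h1⟩ - f with hw
  have hw0 : generator P w = -(a : ℂ) • (w : E) := by
    rw [hw, LinearPMap.map_sub, eq_add_of_sub_eq h2, Submodule.coe_sub, smul_sub]
    abel
  have hnn := hP.re_inner_generator_nonneg w
  rw [hw0, inner_smul_right, inner_self_eq_norm_sq_to_K, ← Complex.ofReal_neg,
    Complex.re_ofReal_mul] at hnn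
  have hn : ‖(w : E)‖ ^ 2 ≤ 0 := by
    have : (((‖(w : E)‖ : ℂ)) ^ 2).re = ‖(w : E)‖ ^ 2 := by
      rw [← Complex.ofReal_pow, Complex.ofReal_re]
    simp only [Complex.coe_algebraMap] at hnn
    rw [this] at hnn
    nlinarith
  have : (w : E) = 0 := norm_eq_zero.1 (pow_eq_zero_iff (two_ne_zero) |>.1
    (le_antisymm hn (sq_nonneg _)))
  exact sub_eq_zero.1 this

end Generator

/-! ### The semigroup of a heat kernel -/

section HeatSemigroup

theorem enorm_coe_nnreal (a : ℝ≥0) : ‖((a : ℝ) : ℂ)‖ₑ = (a : ℝ≥0∞) := by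
  simp [enorm_eq_nnnorm]

variable {X : Type*} [MeasurableSpace X] {p : ℝ → X → X → ℝ≥0} {μ : Measure X}

theorem IsHeatKernel.measurable_left (hp : IsHeatKernel p μ) {t : ℝ} (ht : 0 < t) (x : X) :
    Measurable fun y => p t x y :=
  (hp.measurable_two ht).comp (measurable_const.prodMk measurable_id)

theorem IsHeatKernel.integral_mul (hp : IsHeatKernel p μ) {s t : ℝ} (hs : 0 < s) (ht : 0 < t)
    (x y : X) : ∫ z, ((p s x z : ℝ) : ℂ) * ((p t z y : ℝ) : ℂ) ∂μ = ((p (s + t) x y : ℝ) : ℂ) := by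
  have hm : Measurable fun z => p t z y :=
    (hp.measurable_two ht).comp (measurable_id.prodMk measurable_const)
  have hm' := hp.measurable_left hs x
  have h : ∫ z, (p s x z : ℝ) * (p t z y : ℝ) ∂μ = (p (s + t) x y : ℝ) := by
    rw [integral_eq_lintegral_of_nonneg_ae (Eventually.of_forall fun z => by positivity)
      (by fun_prop)]
    rw [← ENNReal.toReal_ofReal (NNReal.coe_nonneg (p (s + t) x y)), ENNReal.ofReal_coe_nnreal,
      hp.chapman_kolmogorov s t hs ht]
    congr 1
    refine lintegral_congr fun z => ?_
    rw [← NNReal.coe_mul, ENNReal.ofReal_coe_nnreal, ENNReal.coe_mul]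
  rw [← h, ← integral_complex_ofReal]
  simp

/-- Cauchy-Schwarz, with `∫ p(t,x,y)² dμ(y) = p(2t,x,x)` by symmetry and Chapman-Kolmogorov. This is
how the on-diagonal bound enters. -/
theorem IsHeatKernel.enorm_kernelIntegral_sq_le (hp : IsHeatKernel p μ) {t : ℝ} (ht : 0 < t)
    {f : X → ℂ} (hf : MemLp f 2 μ) (x : X) :
    ‖kernelIntegral p μ t f x‖ₑ ^ (2 : ℝ) ≤ p (t + t) x x * eLpNorm f 2 μ ^ (2 : ℝ) := by
  have h1 : ‖kernelIntegral p μ t f x‖ₑ ≤ ∫⁻ y, (p t x y : ℝ≥0∞) * ‖f y‖ₑ ∂μ := by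
    refine (enorm_integral_le_lintegral_enorm _).trans (le_of_eq ?_)
    exact lintegral_congr fun y => by rw [enorm_mul, enorm_coe_nnreal]
  have h2 := h1.trans (ENNReal.lintegral_mul_le_Lp_mul_Lq μ Real.HolderConjugate.two_two
    (f := fun y => (p t x y : ℝ≥0∞)) (g := fun y => ‖f y‖ₑ)
    (by have := hp.measurable_left ht x; fun_prop) hf.1.enorm)
  have hsq : ∀ a : ℝ≥0∞, (a ^ (1 / 2 : ℝ)) ^ (2 : ℝ) = a := fun a => by
    rw [← ENNReal.rpow_mul]; norm_num
  refine (ENNReal.rpow_le_rpow h2 (by norm_num : (0 : ℝ) ≤ 2)).trans (le_of_eq ?_)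
  rw [ENNReal.mul_rpow_of_nonneg _ _ (by norm_num), hsq, hsq,
    eLpNorm_eq_lintegral_rpow_enorm_toReal (by norm_num) (by norm_num),
    hp.chapman_kolmogorov t t ht ht]
  simp only [ENNReal.toReal_ofNat, hsq]
  congr 1
  refine lintegral_congr fun z => ?_
  rw [hp.symm t ht z x, ENNReal.rpow_two, sq]

theorem kernelIntegral_congr {t : ℝ} {f g : X → ℂ} (h : f =ᵐ[μ] g) (x : X) :
    kernelIntegral p μ t f x = kernelIntegral p μ t g x := by
  refine integral_congr_ae ?_
  filter_upwards [h] with y hy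
  rw [hy]

variable [SigmaFinite μ]

theorem semigroup_apply (hp : IsHeatKernel p μ) {t : ℝ} (ht : 0 < t) (f : Lp ℂ 2 μ) :
    semigroup p μ hp t f = (hp.memLp_kernelIntegral ht f).toLp (kernelIntegral p μ t f) := by
  simp only [semigroup, dif_pos ht]
  rfl

theorem coeFn_semigroup (hp : IsHeatKernel p μ) {t : ℝ} (ht : 0 < t) (f : Lp ℂ 2 μ) :
    semigroup p μ hp t f =ᵐ[μ] kernelIntegral p μ t f := by
  rw [semigroup_apply hp ht]
  exact MemLp.coeFn_toLp _

theorem IsHeatKernel.kernelIntegral_add (hp : IsHeatKernel p μ) {s t : ℝ} (hs : 0 < s)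
    (ht : 0 < t) (f : Lp ℂ 2 μ) (x : X) :
    kernelIntegral p μ s (kernelIntegral p μ t f) x = kernelIntegral p μ (s + t) f x := by
  have hfm : Measurable f := (Lp.stronglyMeasurable f).measurable
  have hm1 := hp.measurable_left hs x
  have hm2 := hp.measurable_two ht
  have hm : Measurable fun z : X × X =>
      ((p s x z.1 : ℝ) : ℂ) * (((p t z.1 z.2 : ℝ) : ℂ) * f z.2) := by
    have h1 : Measurable fun z : X × X => p s x z.1 := hm1.comp measurable_fst
    have h2 : Measurable fun z : X × X => f z.2 := hfm.comp measurable_snd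
    fun_prop
  -- Fubini is justified by summing the kernels first: the absolute double integral is `∫ p(s+t,x,y)
  -- |f(y)| dμ(y)`, finite by Cauchy-Schwarz.
  have hintg : Integrable (fun z : X × X =>
      ((p s x z.1 : ℝ) : ℂ) * (((p t z.1 z.2 : ℝ) : ℂ) * f z.2)) (μ.prod μ) := by
    refine ⟨hm.aestronglyMeasurable, ?_⟩
    rw [HasFiniteIntegral, lintegral_prod_symm' _ hm.enorm]
    have h := (hp.integrable (add_pos hs ht) x (Lp.memLp f)).2
    refine lt_of_eq_of_lt (lintegral_congr fun y => ?_) h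
    rw [enorm_mul, enorm_coe_nnreal, hp.chapman_kolmogorov s t hs ht, ← lintegral_mul_const]
    · refine lintegral_congr fun z => ?_
      rw [enorm_mul, enorm_mul, enorm_coe_nnreal, enorm_coe_nnreal, mul_assoc]
    · have : Measurable fun z => p t z y := hm2.comp (measurable_id.prodMk measurable_const)
      fun_prop
  simp only [kernelIntegral]
  simp_rw [← integral_const_mul]
  rw [integral_integral_swap hintg]
  refine integral_congr_ae (Eventually.of_forall fun y => ?_)
  simp only
  rw [← hp.integral_mul hs ht, ← integral_mul_const]
  refine integral_congr_ae (Eventually.of_forall fun z => ?_)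
  simp only [mul_assoc]

theorem IsHeatKernel.inner_semigroup (hp : IsHeatKernel p μ) {t : ℝ} (ht : 0 < t)
    (f g : Lp ℂ 2 μ) :
    inner ℂ (semigroup p μ hp t f) g = inner ℂ f (semigroup p μ hp t g) := by
  have hfm : Measurable f := (Lp.stronglyMeasurable f).measurable
  have hgm : Measurable g := (Lp.stronglyMeasurable g).measurable
  have hm2 := hp.measurable_two ht
  have hm2' : Measurable fun z : X × X => (p t z.1 z.2 : ℝ≥0∞) := by fun_prop
  have hf1 : Measurable fun z : X × X => f z.2 := hfm.comp measurable_snd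
  have hg1 : Measurable fun z : X × X => g z.1 := hgm.comp measurable_fst
  have hm : Measurable fun z : X × X =>
      ((p t z.1 z.2 : ℝ) : ℂ) * ((starRingEnd ℂ) (f z.2) * g z.1) := by
    have h1 : Measurable fun z : X × X => (starRingEnd ℂ) (f z.2) :=
      Complex.continuous_conj.measurable.comp hf1
    fun_prop
  have hfin : ∀ f : Lp ℂ 2 μ, ∫⁻ y, ‖f y‖ₑ ^ (2 : ℝ) ∂μ < ∞ := fun f => by
    have := (eLpNorm_lt_top_iff_lintegral_rpow_enorm_lt_top (p := 2) (f := f) (μ := μ)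
      (by norm_num) (by norm_num)).1 (Lp.memLp f).2
    simpa using this
  have hbd : ∀ h : X → ℝ≥0∞, ∫⁻ x, ∫⁻ y, (p t x y : ℝ≥0∞) * h x ∂μ ∂μ ≤ ∫⁻ x, h x ∂μ := by
    intro h
    refine lintegral_mono fun x => ?_
    rw [lintegral_mul_const _ (by have := hp.measurable_left ht x; fun_prop)]
    exact (mul_le_mul_left (hp.lintegral_le_one t ht x) _).trans_eq (one_mul _)
  have hintg : Integrable (fun z : X × X =>
      ((p t z.1 z.2 : ℝ) : ℂ) * ((starRingEnd ℂ) (f z.2) * g z.1)) (μ.prod μ) := by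
    refine ⟨hm.aestronglyMeasurable, ?_⟩
    -- The bound `|f| |g| ≤ |f|² + |g|²` decouples the variables, and each term is integrable
    -- because the kernel has mass at most one in either variable.
    have hle : ∀ z : X × X, ‖((p t z.1 z.2 : ℝ) : ℂ) * ((starRingEnd ℂ) (f z.2) * g z.1)‖ₑ ≤
        (p t z.1 z.2 : ℝ≥0∞) * ‖f z.2‖ₑ ^ (2 : ℝ) +
          (p t z.1 z.2 : ℝ≥0∞) * ‖g z.1‖ₑ ^ (2 : ℝ) := by
      intro z
      rw [enorm_mul, enorm_coe_nnreal, ← mul_add, enorm_mul, RCLike.enorm_conj]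
      refine mul_le_mul_right ?_ _
      rw [ENNReal.rpow_two, ENNReal.rpow_two, sq, sq]
      rcases le_total ‖f z.2‖ₑ ‖g z.1‖ₑ with h | h
      · exact (mul_le_mul_left h _).trans le_add_self
      · exact (mul_le_mul_right h _).trans le_self_add
    refine (lintegral_mono hle).trans_lt ?_
    rw [lintegral_add_left (by fun_prop), lintegral_prod_symm' _ (by fun_prop),
      lintegral_prod _ (by fun_prop)]
    refine ENNReal.add_lt_top.2 ⟨lt_of_le_of_lt ?_ (hfin f), (hbd _).trans_lt (hfin g)⟩
    refine le_of_eq_of_le ?_ (hbd fun y => ‖f y‖ₑ ^ (2 : ℝ))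
    exact lintegral_congr fun y => lintegral_congr fun x => by rw [hp.symm t ht x y]
  have hL : inner ℂ (semigroup p μ hp t f) g =
      ∫ x, ∫ y, ((p t x y : ℝ) : ℂ) * ((starRingEnd ℂ) (f y) * g x) ∂μ ∂μ := by
    rw [L2.inner_def]
    refine integral_congr_ae ?_
    filter_upwards [coeFn_semigroup hp ht f] with x hx
    rw [hx, RCLike.inner_apply, kernelIntegral, ← integral_conj, mul_comm, ← integral_mul_const]
    refine integral_congr_ae (Eventually.of_forall fun y => ?_)
    simp only [map_mul, Complex.conj_ofReal]
    ring
  have hR : inner ℂ f (semigroup p μ hp t g) =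
      ∫ y, ∫ x, ((p t x y : ℝ) : ℂ) * ((starRingEnd ℂ) (f y) * g x) ∂μ ∂μ := by
    rw [L2.inner_def]
    refine integral_congr_ae ?_
    filter_upwards [coeFn_semigroup hp ht g] with y hy
    rw [hy, RCLike.inner_apply, kernelIntegral, ← integral_mul_const]
    refine integral_congr_ae (Eventually.of_forall fun x => ?_)
    simp only [hp.symm t ht y x]
    ring
  rw [hL, hR, integral_integral_swap hintg]

theorem isSymmetricSemigroup_semigroup (hp : IsHeatKernel p μ) :
    IsSymmetricSemigroup (semigroup p μ hp) where
  zero := by simp only [semigroup, lt_self_iff_false, dif_neg, not_false_eq_true]; rfl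
  add := by
    intro s t hs ht f
    refine Lp.ext ?_
    filter_upwards [coeFn_semigroup hp (add_pos hs ht) f,
      coeFn_semigroup hp hs (semigroup p μ hp t f)] with x h1 h2
    rw [h1, h2, kernelIntegral_congr (coeFn_semigroup hp ht f), hp.kernelIntegral_add hs ht]
  norm_le := by
    intro t f
    by_cases ht : 0 < t
    · rw [semigroup_apply hp ht, Lp.norm_toLp, Lp.norm_def]
      exact ENNReal.toReal_mono (Lp.memLp f).2.ne (hp.eLpNorm_le ht f)
    · simp [semigroup, dif_neg ht]
  symm := by
    intro t f g
    by_cases ht : 0 < t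
    · exact hp.inner_semigroup ht f g
    · simp [semigroup, dif_neg ht]
  tendsto := by
    intro f
    rw [tendsto_iff_norm_sub_tendsto_zero]
    have h := (ENNReal.tendsto_toReal ENNReal.zero_ne_top).comp
      (hp.tendsto_zero f (Lp.memLp f))
    rw [ENNReal.toReal_zero] at h
    refine h.congr' ?_
    filter_upwards [self_mem_nhdsWithin] with t ht
    rw [Function.comp_apply, Lp.norm_def]
    congr 1
    refine eLpNorm_congr_ae ?_
    filter_upwards [Lp.coeFn_sub (semigroup p μ hp t f) f, coeFn_semigroup hp ht f] with x h1 h2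
    rw [h1, Pi.sub_apply, h2]

end HeatSemigroup

/-! ### Compactness of Hilbert-Schmidt operators -/

section HilbertSchmidt

variable {E F : Type*} [NormedAddCommGroup E] [InnerProductSpace ℂ E]
  [NormedAddCommGroup F] [NormedSpace ℂ F]

theorem isCompactOperator_of_forall_exists_norm_sub_le [CompleteSpace F] {K : E →L[ℂ] F}
    (h : ∀ ε : ℝ, 0 < ε → ∃ L : E →L[ℂ] F, IsCompactOperator L ∧ ∀ f, ‖K f - L f‖ ≤ ε * ‖f‖) :
    IsCompactOperator K := by
  have hcl : IsClosed {L : E →L[ℂ] F | IsCompactOperator L} := isClosed_setOfPred_isCompactOperator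
  refine hcl.closure_subset (Metric.mem_closure_iff.2 fun ε hε => ?_)
  obtain ⟨L, hL, hKL⟩ := h (ε / 2) (half_pos hε)
  refine ⟨L, hL, ?_⟩
  rw [dist_eq_norm]
  exact (ContinuousLinearMap.opNorm_le_bound _ (half_pos hε).le hKL).trans_lt (half_lt_self hε)

theorem orthonormal_cons {n : ℕ} {e : Fin n → E} (he : Orthonormal ℂ e) {f : E} (hf : ‖f‖ = 1)
    (hfe : ∀ i, inner ℂ (e i) f = 0) : Orthonormal ℂ (Fin.cons f e : Fin (n + 1) → E) := by
  refine ⟨fun i => ?_, fun i j => ?_⟩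
  · refine Fin.cases ?_ (fun i => ?_) i
    · simpa using hf
    · simpa using he.1 i
  · refine Fin.cases ?_ (fun i => ?_) i <;> refine Fin.cases ?_ (fun j => ?_) j
    · simp
    · intro _
      simpa using inner_eq_zero_symm.1 (hfe j)
    · intro _
      simpa using hfe i
    · intro hij
      simpa using he.2 (by simpa using hij)

/-- An orthonormal family that nearly attains the supremum of the sums leaves `K` with norm at most
`ε` on its orthogonal complement, since one more vector cannot add `ε²`. So `K` is a norm limit of
finite-rank operators. -/
theorem isCompactOperator_of_sum_sq_le [CompleteSpace F] {K : E →L[ℂ] F} {C : ℝ}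
    (h : ∀ (n : ℕ) (e : Fin n → E), Orthonormal ℂ e → ∑ i, ‖K (e i)‖ ^ 2 ≤ C) :
    IsCompactOperator K := by
  refine isCompactOperator_of_forall_exists_norm_sub_le fun ε hε => ?_
  set S : Set ℝ := {r | ∃ (n : ℕ) (e : Fin n → E), Orthonormal ℂ e ∧ r = ∑ i, ‖K (e i)‖ ^ 2}
    with hS
  have hne : S.Nonempty := ⟨0, 0, Fin.elim0, by simp [Orthonormal, Pairwise], by simp⟩
  have hbdd : BddAbove S := ⟨C, by
    rintro r ⟨n, e, he, rfl⟩
    exact h n e he⟩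
  obtain ⟨r, ⟨n, e, he, rfl⟩, hr⟩ := exists_lt_of_lt_csSup hne
    (show sSup S - ε ^ 2 < sSup S by have := pow_pos hε 2; linarith)
  let U : Submodule ℂ E := Submodule.span ℂ (Set.range e)
  have hfin : FiniteDimensional ℂ U := FiniteDimensional.span_of_finite ℂ (Set.finite_range e)
  have horth : ∀ f ∈ Uᗮ, ‖K f‖ ≤ ε * ‖f‖ := by
    intro f hf
    rcases eq_or_ne f 0 with rfl | hf0
    · simp
    have hn : 0 < ‖f‖ := norm_pos_iff.2 hf0
    set g : E := ((‖f‖⁻¹ : ℝ) : ℂ) • f with hg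
    have hgn : ‖g‖ = 1 := by
      rw [hg, norm_smul, Complex.norm_real, norm_inv, norm_norm, inv_mul_cancel₀ hn.ne']
    have hge : ∀ i, inner ℂ (e i) g = 0 := fun i => by
      rw [hg, inner_smul_right, hf (e i) (Submodule.subset_span ⟨i, rfl⟩), mul_zero]
    have hle := le_csSup hbdd ⟨n + 1, _, orthonormal_cons he hgn hge, rfl⟩
    rw [Fin.sum_univ_succ] at hle
    simp only [Fin.cons_zero, Fin.cons_succ] at hle
    have hlt : ‖K g‖ ^ 2 < ε ^ 2 := by linarith
    have hKg := lt_of_pow_lt_pow_left₀ 2 hε.le hlt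
    rw [hg, map_smul, norm_smul, Complex.norm_real, norm_inv, norm_norm, inv_mul_eq_div,
      div_lt_iff₀ hn] at hKg
    exact hKg.le
  refine ⟨K ∘L U.starProjection, ?_, fun f => ?_⟩
  · have := FiniteDimensional.proper ℂ U
    exact (isCompactOperator_of_locallyCompactSpace_rng
      (K ∘L U.subtypeL)).comp_clm U.orthogonalProjectionOnto
  · rw [ContinuousLinearMap.comp_apply, ← map_sub]
    refine (horth _ (Submodule.sub_starProjection_mem_orthogonal f)).trans ?_
    refine mul_le_mul_of_nonneg_left ?_ hε.le
    rw [← Submodule.starProjection_orthogonal_val]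
    exact Submodule.norm_starProjection_apply_le _ _

theorem norm_sq_eq_integral {X : Type*} [MeasurableSpace X] {μ : Measure X} (h : Lp ℂ 2 μ) :
    ‖h‖ ^ 2 = ∫ x, ‖h x‖ ^ 2 ∂μ := by
  have h1 := inner_self_eq_norm_sq_to_K (𝕜 := ℂ) h
  rw [L2.inner_def] at h1
  have h2 : ∀ x, inner ℂ (h x) (h x) = ((‖h x‖ ^ 2 : ℝ) : ℂ) := fun x => by
    rw [inner_self_eq_norm_sq_to_K]; simp
  simp_rw [h2] at h1
  rw [integral_complex_ofReal] at h1
  exact (Complex.ofReal_injective (by simpa using h1)).symm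

/-- Pointwise domination plays the role of a square-integrable kernel: it forces `∑ |K e_i (x)|² ≤
g(x)²` almost everywhere for orthonormal `e_i`, and integration bounds the Hilbert-Schmidt sums. -/
theorem isCompactOperator_of_ae_norm_le {X : Type*} [MeasurableSpace X] {μ : Measure X}
    {K : E →L[ℂ] Lp ℂ 2 μ} {g : X → ℝ} (hg : MemLp g 2 μ)
    (h : ∀ f, ∀ᵐ x ∂μ, ‖K f x‖ ≤ g x * ‖f‖) : IsCompactOperator K := by
  refine isCompactOperator_of_sum_sq_le (C := ∫ x, g x ^ 2 ∂μ) fun n e he => ?_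
  have hlin : ∀ c : Fin n → ℂ, ∀ᵐ x ∂μ,
      ‖∑ i, c i * K (e i) x‖ ≤ g x * √(∑ i, ‖c i‖ ^ 2) := by
    intro c
    have hnorm : ‖∑ i, c i • e i‖ = √(∑ i, ‖c i‖ ^ 2) := by
      rw [eq_comm, Real.sqrt_eq_iff_mul_self_eq (by positivity) (norm_nonneg _), ← sq]
      have := he.inner_sum c c Finset.univ
      rw [inner_self_eq_norm_sq_to_K] at this
      simp only [RCLike.conj_mul] at this
      exact_mod_cast this.symm
    have hsum : K (∑ i, c i • e i) =ᵐ[μ] fun x => ∑ i, c i * K (e i) x := by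
      rw [map_sum]
      refine (Lp.coeFn_finsetSum _ _).trans ?_
      have : ∀ i, (K (c i • e i) : X → ℂ) =ᵐ[μ] fun x => c i * K (e i) x := fun i => by
        rw [map_smul]
        filter_upwards [Lp.coeFn_smul (c i) (K (e i))] with x hx
        rw [hx, Pi.smul_apply, smul_eq_mul]
      filter_upwards [ae_all_iff.2 this] with x hx
      rw [Finset.sum_apply]
      exact Finset.sum_congr rfl fun i _ => hx i
    filter_upwards [h (∑ i, c i • e i), hsum] with x h1 h2
    rwa [h2, hnorm] at h1
  have hall : ∀ᵐ x ∂μ, ∑ i, ‖K (e i) x‖ ^ 2 ≤ g x ^ 2 := by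
    -- The exceptional null set depends on the coefficients `c`, so a countable dense family is used
    -- first and continuity extends the bound to all `c`.
    have h1 := ae_all_iff.2 fun k : ℕ => hlin (TopologicalSpace.denseSeq (Fin n → ℂ) k)
    filter_upwards [h1] with x hx
    have hcl : IsClosed {c : Fin n → ℂ | ‖∑ i, c i * K (e i) x‖ ≤ g x * √(∑ i, ‖c i‖ ^ 2)} :=
      isClosed_le (by fun_prop) (by fun_prop)
    have hmem : ∀ c : Fin n → ℂ, ‖∑ i, c i * K (e i) x‖ ≤ g x * √(∑ i, ‖c i‖ ^ 2) := fun c =>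
      hcl.closure_subset_iff.2 (Set.range_subset_iff.2 hx)
        ((TopologicalSpace.denseRange_denseSeq (Fin n → ℂ)) c)
    -- The extremal coefficients, conjugate to the values, give `s ≤ g x * √s`.
    have h2 := hmem fun i => (starRingEnd ℂ) (K (e i) x)
    simp only [RCLike.norm_conj, RCLike.conj_mul] at h2
    set s := ∑ i, ‖K (e i) x‖ ^ 2 with hs
    have hs0 : 0 ≤ s := by positivity
    have h3 : ‖∑ i, ((‖K (e i) x‖ : ℝ) : ℂ) ^ 2‖ = s := by
      rw [← Complex.norm_of_nonneg hs0, hs]; push_cast; rfl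
    have h4 : s ≤ g x * √s := h3 ▸ h2
    rcases hs0.eq_or_lt with h0 | h0
    · rw [← h0]; positivity
    · have h5 := Real.sqrt_pos.2 h0
      have h6 := Real.mul_self_sqrt hs0
      have h7 : √s ≤ g x := le_of_mul_le_mul_right (h6.trans_le h4) h5
      nlinarith
  have hintg : ∀ i, Integrable (fun x => ‖K (e i) x‖ ^ 2) μ := fun i =>
    (Lp.memLp (K (e i))).integrable_norm_pow (by norm_num)
  simp_rw [norm_sq_eq_integral]
  rw [← integral_finsetSum _ fun i _ => hintg i]
  exact integral_mono_ae (integrable_finsetSum _ fun i _ => hintg i) hg.integrable_sq hall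

end HilbertSchmidt

/-! ### Multiplication operators composed with bounded operators -/

section Multiplication

variable {E : Type*} [NormedAddCommGroup E] [InnerProductSpace ℂ E]
  {X : Type*} [MeasurableSpace X] {μ : Measure X}

theorem eLpNorm_coeFn (f : Lp ℂ 2 μ) : eLpNorm f 2 μ = ENNReal.ofReal ‖f‖ := by
  rw [Lp.norm_def, ENNReal.ofReal_toReal (Lp.memLp f).2.ne]

theorem Lp_norm_le_of_ae_eq {f : Lp ℂ 2 μ} {g : X → ℂ} {C : ℝ} (hC : 0 ≤ C) (h : f =ᵐ[μ] g)
    (hg : eLpNorm g 2 μ ≤ ENNReal.ofReal C) : ‖f‖ ≤ C := by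
  rw [Lp.norm_def, eLpNorm_congr_ae h]
  exact ENNReal.toReal_le_of_le_ofReal hC hg

/-- `K` is the operator `f ↦ W · R f`. -/
def IsMulComp (W : X → ℂ) (R K : E →L[ℂ] Lp ℂ 2 μ) : Prop :=
  ∀ f, K f =ᵐ[μ] fun x => W x * R f x

theorem IsMulComp.congr {W W' : X → ℂ} {R K : E →L[ℂ] Lp ℂ 2 μ} (h : IsMulComp W R K)
    (hW : W =ᵐ[μ] W') : IsMulComp W' R K := by
  intro f
  filter_upwards [h f, hW] with x h1 h2
  rw [h1, h2]

theorem IsMulComp.add {W W' : X → ℂ} {R K K' : E →L[ℂ] Lp ℂ 2 μ} (h : IsMulComp W R K)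
    (h' : IsMulComp W' R K') : IsMulComp (fun x => W x + W' x) R (K + K') := by
  intro f
  rw [add_apply]
  filter_upwards [h f, h' f, Lp.coeFn_add (K f) (K' f)] with x h1 h2 h3
  rw [h3, Pi.add_apply, h1, h2, add_mul]

theorem IsMulComp.comp {F : Type*} [NormedAddCommGroup F] [InnerProductSpace ℂ F] {W : X → ℂ}
    {R K : E →L[ℂ] Lp ℂ 2 μ} (h : IsMulComp W R K) (L : F →L[ℂ] E) :
    IsMulComp W (R ∘L L) (K ∘L L) := fun f => h (L f)

theorem IsMulComp.coeFn_sub {W W' : X → ℂ} {R K K' : E →L[ℂ] Lp ℂ 2 μ} (h : IsMulComp W R K)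
    (h' : IsMulComp W' R K') (f : E) :
    (K f - K' f : Lp ℂ 2 μ) =ᵐ[μ] fun x => (W x - W' x) * R f x := by
  filter_upwards [h f, h' f, Lp.coeFn_sub (K f) (K' f)] with x h1 h2 h3
  rw [h3, Pi.sub_apply, h1, h2, sub_mul]

theorem exists_isMulComp {W : X → ℂ} (hW : AEStronglyMeasurable W μ) (R : E →L[ℂ] Lp ℂ 2 μ)
    {C : ℝ} (hC : 0 ≤ C)
    (h : ∀ f, eLpNorm (fun x => W x * R f x) 2 μ ≤ ENNReal.ofReal (C * ‖f‖)) :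
    ∃ K : E →L[ℂ] Lp ℂ 2 μ, IsMulComp W R K ∧ ∀ f, ‖K f‖ ≤ C * ‖f‖ := by
  have hmem : ∀ f, MemLp (fun x => W x * R f x) 2 μ := fun f =>
    ⟨hW.mul (Lp.aestronglyMeasurable _), (h f).trans_lt ENNReal.ofReal_lt_top⟩
  have hnorm : ∀ f, ‖(hmem f).toLp‖ ≤ C * ‖f‖ := fun f =>
    Lp_norm_le_of_ae_eq (mul_nonneg hC (norm_nonneg _)) (MemLp.coeFn_toLp _) (h f)
  refine ⟨LinearMap.mkContinuous
    { toFun := fun f => (hmem f).toLp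
      map_add' := fun f g => ?_
      map_smul' := fun c f => ?_ } C hnorm, fun f => MemLp.coeFn_toLp (hmem f), hnorm⟩
  · rw [← MemLp.toLp_add]
    refine MemLp.toLp_congr _ _ ?_
    rw [map_add]
    filter_upwards [Lp.coeFn_add (R f) (R g)] with x hx
    rw [hx, Pi.add_apply, Pi.add_apply, mul_add]
  · rw [RingHom.id_apply, ← MemLp.toLp_const_smul]
    refine MemLp.toLp_congr _ _ ?_
    rw [map_smul]
    filter_upwards [Lp.coeFn_smul c (R f)] with x hx
    rw [hx, Pi.smul_apply, Pi.smul_apply, smul_eq_mul, smul_eq_mul]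
    ring

theorem eLpNorm_mul_le_of_ae_norm_le {W : X → ℂ} {C : ℝ} (hC : 0 ≤ C)
    (h : ∀ᵐ x ∂μ, ‖W x‖ ≤ C) (f : Lp ℂ 2 μ) :
    eLpNorm (fun x => W x * f x) 2 μ ≤ ENNReal.ofReal (C * ‖f‖) := by
  rw [ENNReal.ofReal_mul hC, ← eLpNorm_coeFn]
  refine eLpNorm_le_mul_eLpNorm_of_ae_le_mul ?_ 2
  filter_upwards [h] with x hx
  rw [norm_mul]
  exact mul_le_mul_of_nonneg_right hx (norm_nonneg _)

theorem exists_isMulComp_id {W : X → ℂ} (hW : AEStronglyMeasurable W μ) {C : ℝ} (hC : 0 ≤ C)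
    (h : ∀ᵐ x ∂μ, ‖W x‖ ≤ C) :
    ∃ M : Lp ℂ 2 μ →L[ℂ] Lp ℂ 2 μ, (∀ f, M f =ᵐ[μ] fun x => W x * f x) ∧
      ∀ f, ‖M f‖ ≤ C * ‖f‖ :=
  exists_isMulComp hW (ContinuousLinearMap.id ℂ _) hC fun f =>
    eLpNorm_mul_le_of_ae_norm_le hC h f

theorem exists_isCompactOperator_isMulComp {W : X → ℂ} (hW : AEStronglyMeasurable W μ)
    {R : E →L[ℂ] Lp ℂ 2 μ}
    (h : ∀ ε : ℝ, 0 < ε → ∃ (W' : X → ℂ) (K' : E →L[ℂ] Lp ℂ 2 μ), AEStronglyMeasurable W' μ ∧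
      IsCompactOperator K' ∧ IsMulComp W' R K' ∧
      ∀ f, eLpNorm (fun x => (W x - W' x) * R f x) 2 μ ≤ ENNReal.ofReal (ε * ‖f‖)) :
    ∃ K : E →L[ℂ] Lp ℂ 2 μ, IsCompactOperator K ∧ IsMulComp W R K := by
  -- One approximant suffices for boundedness: `W R = W₀ R + (W - W₀) R`.
  obtain ⟨W₀, K₀, hW₀, -, hK₀, h₀⟩ := h 1 one_pos
  obtain ⟨D, hD, -⟩ := exists_isMulComp (hW.sub hW₀) R zero_le_one h₀
  have hK : IsMulComp W R (K₀ + D) := (hK₀.add hD).congr (Eventually.of_forall fun x => by simp)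
  refine ⟨K₀ + D, isCompactOperator_of_forall_exists_norm_sub_le fun ε hε => ?_, hK⟩
  obtain ⟨W', K', hW', hc, hK', h'⟩ := h ε hε
  exact ⟨K', hc, fun f => Lp_norm_le_of_ae_eq (by positivity) (hK.coeFn_sub hK' f) (h' f)⟩

theorem IsMulComp.exists_mulOperator_eq {W : X → ℂ} {R K : Lp ℂ 2 μ →L[ℂ] Lp ℂ 2 μ}
    (h : IsMulComp W R K) (f : Lp ℂ 2 μ) :
    ∃ hf : R f ∈ (mulOperator μ W).domain, mulOperator μ W ⟨R f, hf⟩ = K f := by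
  have hf : MemLp (fun x => W x * R f x) 2 μ := (Lp.memLp (K f)).ae_eq (h f)
  exact ⟨hf, Lp.ext ((MemLp.coeFn_toLp hf).trans (h f).symm)⟩

theorem isFormalAdjoint_mulOperator (V : X → ℝ) :
    (mulOperator μ fun x => (V x : ℂ)).IsFormalAdjoint (mulOperator μ fun x => (V x : ℂ)) := by
  intro f g
  have hf : mulOperator μ (fun x => (V x : ℂ)) f =ᵐ[μ] fun x => V x * (f : Lp ℂ 2 μ) x :=
    MemLp.coeFn_toLp f.2
  have hg : mulOperator μ (fun x => (V x : ℂ)) g =ᵐ[μ] fun x => V x * (g : Lp ℂ 2 μ) x :=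
    MemLp.coeFn_toLp g.2
  rw [L2.inner_def, L2.inner_def]
  refine integral_congr_ae ?_
  filter_upwards [hf, hg] with x h1 h2
  rw [h1, h2]
  simp only [RCLike.inner_apply, map_mul, Complex.conj_ofReal]
  ring

end Multiplication

/-! ### Relative bounds and relative compactness of potentials -/

section Potentials

variable {X : Type*} [MeasurableSpace X] {p : ℝ → X → X → ℝ≥0} {μ : Measure X} {F₁ : X → ℝ}

theorem absolutelyContinuous_weighted (hF : Measurable F₁) (hpos : ∀ x, 0 < F₁ x) :
    μ ≪ weighted μ F₁ :=
  withDensity_absolutelyContinuous' (by fun_prop)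
    (Eventually.of_forall fun x => by simpa using hpos x)

variable [SigmaFinite μ]

/-- Split `|u|² = (|u|²)^{1/q} (|u|²)^{1-1/q}` for `u = P_t f`. The on-diagonal bound controls the
first factor pointwise by `(F₁ m ‖f‖²)^{1/q}`, contractivity controls the integral of `|u|²`, and
Hölder combines them. -/
theorem eLpNorm_mul_semigroup_le (hp : IsHeatKernel p μ) (hF : Measurable F₁)
    {m q t : ℝ} (hq : 1 ≤ q) (ht : 0 < t) (hm : 0 < m)
    (hpm : ∀ x, (p (t + t) x x : ℝ) ≤ F₁ x * m) {W : X → ℂ}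
    (hW : AEStronglyMeasurable W μ) (f : Lp ℂ 2 μ) :
    eLpNorm (fun x => W x * semigroup p μ hp t f x) 2 μ ≤
      eLpNorm W (ENNReal.ofReal (2 * q)) (weighted μ F₁) *
        ENNReal.ofReal (m ^ (1 / (2 * q)) * ‖f‖) := by
  have hq0 : 0 < q := by linarith
  have hqi : 0 ≤ 1 / q := by positivity
  have hqi' : 0 ≤ 1 - 1 / q := by rw [sub_nonneg, div_le_one hq0]; exact hq
  set u := semigroup p μ hp t f with hu
  set N := eLpNorm f 2 μ with hN
  set c : ℝ≥0∞ := ENNReal.ofReal m * N ^ (2 : ℝ) with hc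
  have hum : AEStronglyMeasurable u μ := Lp.aestronglyMeasurable u
  have hpt : ∀ᵐ x ∂μ, ‖u x‖ₑ ^ (2 : ℝ) ≤ ENNReal.ofReal (F₁ x) * c := by
    filter_upwards [coeFn_semigroup hp ht f] with x hx
    rw [hx]
    refine (hp.enorm_kernelIntegral_sq_le ht (Lp.memLp f) x).trans ?_
    rw [hc, ← mul_assoc, ← ENNReal.ofReal_mul' hm.le]
    refine mul_le_mul_left ?_ _
    rw [← ENNReal.ofReal_coe_nnreal]
    exact ENNReal.ofReal_le_ofReal (hpm x)
  have hnorm : ∫⁻ x, ‖u x‖ₑ ^ (2 : ℝ) ∂μ ≤ N ^ (2 : ℝ) := by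
    have h1 : eLpNorm u 2 μ ≤ N := by
      rw [eLpNorm_coeFn, hN, eLpNorm_coeFn]
      exact ENNReal.ofReal_le_ofReal ((isSymmetricSemigroup_semigroup hp).norm_le t f)
    rw [eLpNorm_eq_lintegral_rpow_enorm_toReal (by norm_num) (by norm_num)] at h1
    have h2 := ENNReal.rpow_le_rpow h1 (by norm_num : (0 : ℝ) ≤ 2)
    rw [← ENNReal.rpow_mul] at h2
    simpa using h2
  have hWint : ∫⁻ x, ‖W x‖ₑ ^ (2 * q) * (ENNReal.ofReal (F₁ x) * c) ∂μ =
      (∫⁻ x, ‖W x‖ₑ ^ (2 * q) ∂(weighted μ F₁)) * c := by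
    rw [weighted, lintegral_withDensity_eq_lintegral_mul₀ (by fun_prop)
      (hW.enorm.pow_const _), ← lintegral_mul_const'' _ (by
        have := hW.enorm.pow_const (2 * q)
        exact (AEMeasurable.mul (by fun_prop) this))]
    refine lintegral_congr fun x => ?_
    simp only [Pi.mul_apply]
    ring
  have hmain : ∫⁻ x, ‖W x * u x‖ₑ ^ (2 : ℝ) ∂μ ≤
      ((∫⁻ x, ‖W x‖ₑ ^ (2 * q) ∂(weighted μ F₁)) * c) ^ (1 / q) *
        (N ^ (2 : ℝ)) ^ (1 - 1 / q) := by
    have h1 : ∫⁻ x, ‖W x * u x‖ₑ ^ (2 : ℝ) ∂μ ≤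
        ∫⁻ x, (‖W x‖ₑ ^ (2 * q) * (ENNReal.ofReal (F₁ x) * c)) ^ (1 / q) *
          (‖u x‖ₑ ^ (2 : ℝ)) ^ (1 - 1 / q) ∂μ := by
      refine lintegral_mono_ae ?_
      filter_upwards [hpt] with x hx
      rw [enorm_mul, ENNReal.mul_rpow_of_nonneg _ _ (by norm_num : (0 : ℝ) ≤ 2),
        ENNReal.mul_rpow_of_nonneg _ _ hqi, ← ENNReal.rpow_mul,
        show 2 * q * (1 / q) = 2 by field_simp, mul_assoc]
      refine mul_le_mul_right ?_ _
      calc ‖u x‖ₑ ^ (2 : ℝ) = (‖u x‖ₑ ^ (2 : ℝ)) ^ (1 / q) * (‖u x‖ₑ ^ (2 : ℝ)) ^ (1 - 1 / q) := by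
            rw [← ENNReal.rpow_add_of_nonneg _ _ hqi hqi', add_sub_cancel, ENNReal.rpow_one]
        _ ≤ _ := mul_le_mul_left (ENNReal.rpow_le_rpow hx hqi) _
    refine h1.trans ((ENNReal.lintegral_mul_norm_pow_le ?_ (hum.enorm.pow_const _) hqi hqi'
      (by ring)).trans ?_)
    · exact (hW.enorm.pow_const _).mul (by fun_prop)
    · rw [hWint]
      exact mul_le_mul_right (ENNReal.rpow_le_rpow hnorm hqi') _
  have h2q : ENNReal.ofReal (2 * q) ≠ 0 := by
    rw [ne_eq, ENNReal.ofReal_eq_zero, not_le]; positivity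
  rw [eLpNorm_eq_lintegral_rpow_enorm_toReal (by norm_num) (by norm_num),
    eLpNorm_eq_lintegral_rpow_enorm_toReal h2q ENNReal.ofReal_ne_top,
    ENNReal.toReal_ofReal (by positivity), ENNReal.ofReal_mul (by positivity), ← eLpNorm_coeFn,
    ← hN, ENNReal.toReal_ofNat]
  refine (ENNReal.rpow_le_rpow hmain (by norm_num : (0 : ℝ) ≤ 1 / 2)).trans (le_of_eq ?_)
  rw [ENNReal.mul_rpow_of_nonneg _ _ (by norm_num), ENNReal.mul_rpow_of_nonneg _ _ hqi,
    ENNReal.mul_rpow_of_nonneg _ _ (by norm_num), hc, ENNReal.mul_rpow_of_nonneg _ _ hqi,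
    ENNReal.mul_rpow_of_nonneg _ _ (by norm_num), ← ENNReal.rpow_mul, ← ENNReal.rpow_mul,
    ← ENNReal.rpow_mul, ← ENNReal.rpow_mul, ← ENNReal.rpow_mul, ← ENNReal.rpow_mul,
    ← ENNReal.ofReal_rpow_of_pos hm, show 1 / q * (1 / 2) = 1 / (2 * q) by field_simp, mul_assoc,
    mul_assoc, ← ENNReal.rpow_add_of_nonneg _ _ (by positivity) (by positivity),
    show 2 * (1 / (2 * q)) + 2 * ((1 - 1 / q) * (1 / 2)) = 1 by field_simp; ring,
    ENNReal.rpow_one]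

/-- Multiplication by the truncation of `W` to `{‖W‖ ≤ n}` is bounded and passes through the
integral, with a bound uniform in `n`; Fatou removes the truncation. -/
theorem eLpNorm_mul_laplaceTransform_le (hp : IsHeatKernel p μ) {W : X → ℂ}
    (hW : AEStronglyMeasurable W μ) {a N : ℝ} (ha : 0 < a) (hN : 0 ≤ N) {φ : ℝ → ℝ}
    (hφ : IntegrableOn (fun t => Real.exp (-a * t) * φ t) (Set.Ioi 0)) (hφ0 : ∀ t, 0 < t → 0 ≤ φ t)
    (hWφ : ∀ t, 0 < t → ∀ f, eLpNorm (fun x => W x * semigroup p μ hp t f x) 2 μ ≤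
      ENNReal.ofReal (N * (φ t * ‖f‖))) (f : Lp ℂ 2 μ) :
    eLpNorm (fun x => W x * laplaceTransform (isSymmetricSemigroup_semigroup hp) ha f x) 2 μ ≤
      ENNReal.ofReal (N * (∫ t in Set.Ioi (0 : ℝ), Real.exp (-a * t) * φ t) * ‖f‖) := by
  set R := laplaceTransform (isSymmetricSemigroup_semigroup hp) ha with hR
  let Wn : ℕ → X → ℂ := fun n => {x | ‖W x‖ ≤ n}.indicator W
  have hWn : ∀ n, AEStronglyMeasurable (Wn n) μ := fun n =>
    hW.indicator₀ (nullMeasurableSet_le hW.norm.aemeasurable aemeasurable_const)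
  have hWnle : ∀ n x, ‖Wn n x‖ ≤ ‖W x‖ := fun n x => norm_indicator_le_norm_self _ _
  have hWnbd : ∀ n x, ‖Wn n x‖ ≤ n := by
    intro n x
    by_cases hx : ‖W x‖ ≤ n
    · simp [Wn, hx]
    · simp [Wn, hx]
  have hlim : ∀ x, Tendsto (fun n => Wn n x * R f x) atTop (𝓝 (W x * R f x)) := by
    intro x
    refine tendsto_const_nhds.congr' ?_
    filter_upwards [eventually_ge_atTop ⌈‖W x‖⌉₊] with n hn
    have : ‖W x‖ ≤ n := (Nat.le_ceil _).trans (by exact_mod_cast hn)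
    simp [Wn, this]
  refine (Lp.eLpNorm_lim_le_liminf_eLpNorm
    (fun n => (hWn n).mul (Lp.aestronglyMeasurable (R f))) _ (Eventually.of_forall hlim)).trans ?_
  refine liminf_le_of_le (by isBoundedDefault) fun b hb => ?_
  obtain ⟨n, hn⟩ := hb.exists
  refine hn.trans ?_
  obtain ⟨M, hM, -⟩ := exists_isMulComp_id (hWn n) (Nat.cast_nonneg n)
    (Eventually.of_forall (hWnbd n))
  have hMt : ∀ t, 0 < t → ‖M (semigroup p μ hp t f)‖ ≤ N * ‖f‖ * φ t := by
    intro t ht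
    have hnn := hφ0 t ht
    refine Lp_norm_le_of_ae_eq (by positivity) (hM _) ?_
    rw [show N * ‖f‖ * φ t = N * (φ t * ‖f‖) by ring]
    refine le_trans (eLpNorm_mono fun x => ?_) (hWφ t ht f)
    rw [norm_mul, norm_mul]
    exact mul_le_mul_of_nonneg_right (hWnle n x) (norm_nonneg _)
  have hintg : IntegrableOn (fun t => Real.exp (-a * t) * (N * ‖f‖ * φ t)) (Set.Ioi 0) :=
    (hφ.const_mul (N * ‖f‖)).congr (Eventually.of_forall fun t => by
      simp only; ring)
  have h1 := norm_map_laplaceTransform_le (isSymmetricSemigroup_semigroup hp) ha M f hintg hMt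
  have h2 : eLpNorm (fun x => Wn n x * R f x) 2 μ = ENNReal.ofReal ‖M (R f)‖ := by
    rw [← eLpNorm_coeFn, eLpNorm_congr_ae (hM (R f))]
  change eLpNorm (fun x => Wn n x * R f x) 2 μ ≤ _
  rw [h2]
  refine ENNReal.ofReal_le_ofReal (h1.trans (le_of_eq ?_))
  rw [mul_right_comm, ← integral_const_mul]
  exact integral_congr_ae (Eventually.of_forall fun t => by simp only; ring)

/-- `W P_s` is Hilbert-Schmidt with dominating function `|W| √(F₁ F₂(2s))`, and `W R` is the norm
limit of `e^{-as} W P_s R` as `s → 0`. -/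
theorem exists_isCompactOperator_of_bounded (hp : IsHeatKernel p μ) (hF : Measurable F₁)
    (hpos : ∀ x, 0 < F₁ x) {F₂ : ℝ → ℝ} (hF₂ : ∀ t, 0 < t → 0 < F₂ t)
    (hpF : ∀ t, 0 < t → ∀ x, (p t x x : ℝ) ≤ F₁ x * F₂ t) {W : X → ℂ} {C : ℝ} (hC : 0 ≤ C)
    (hWC : ∀ᵐ x ∂μ, ‖W x‖ ≤ C) (hW : MemLp W 2 (weighted μ F₁)) {a : ℝ} (ha : 0 < a) :
    ∃ K : Lp ℂ 2 μ →L[ℂ] Lp ℂ 2 μ, IsCompactOperator K ∧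
      IsMulComp W (laplaceTransform (isSymmetricSemigroup_semigroup hp) ha) K := by
  have hWm : AEStronglyMeasurable W μ := hW.1.mono_ac (absolutelyContinuous_weighted hF hpos)
  set R := laplaceTransform (isSymmetricSemigroup_semigroup hp) ha with hR
  obtain ⟨M, hM, hMC⟩ := exists_isMulComp_id hWm hC hWC
  have hcomp : ∀ s, 0 < s → IsCompactOperator (M ∘L semigroup p μ hp s) := by
    intro s hs
    have hm : 0 < F₂ (s + s) := hF₂ _ (add_pos hs hs)
    refine isCompactOperator_of_ae_norm_le (g := fun x => √(F₂ (s + s)) * (‖W x‖ * √(F₁ x))) ?_ ?_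
    · refine MemLp.const_mul ⟨hWm.norm.mul (by fun_prop), ?_⟩ _
      rw [eLpNorm_lt_top_iff_lintegral_rpow_enorm_lt_top (by norm_num) (by norm_num)]
      have h1 := (eLpNorm_lt_top_iff_lintegral_rpow_enorm_lt_top (by norm_num) (by norm_num)).1 hW.2
      rw [weighted, lintegral_withDensity_eq_lintegral_mul₀ (by fun_prop)
        (hWm.enorm.pow_const _)] at h1
      refine lt_of_eq_of_lt (lintegral_congr fun x => ?_) h1
      have h2 : ‖√(F₁ x)‖ₑ ^ (2 : ℝ) = ENNReal.ofReal (F₁ x) := by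
        rw [Real.enorm_eq_ofReal (Real.sqrt_nonneg _), ENNReal.rpow_two,
          ← ENNReal.ofReal_pow (Real.sqrt_nonneg _), Real.sq_sqrt (hpos x).le]
      simp only [Pi.mul_apply, ENNReal.toReal_ofNat]
      rw [enorm_mul, enorm_norm, ENNReal.mul_rpow_of_nonneg _ _ (by norm_num), h2, mul_comm]
    · intro f
      filter_upwards [hM (semigroup p μ hp s f), coeFn_semigroup hp hs f] with x h1 h2
      rw [ContinuousLinearMap.comp_apply, h1, h2, norm_mul]
      have h3 := hp.enorm_kernelIntegral_sq_le hs (Lp.memLp f) x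
      have h4 : ‖kernelIntegral p μ s f x‖ ^ 2 ≤ p (s + s) x x * ‖f‖ ^ 2 := by
        rw [ENNReal.rpow_two, ENNReal.rpow_two, eLpNorm_coeFn, ← ofReal_norm,
          ← ENNReal.ofReal_pow (norm_nonneg _), ← ENNReal.ofReal_pow (norm_nonneg _),
          ← ENNReal.ofReal_coe_nnreal, ← ENNReal.ofReal_mul (NNReal.coe_nonneg _)] at h3
        exact (ENNReal.ofReal_le_ofReal_iff (by positivity)).1 h3
      have h5 : ‖kernelIntegral p μ s f x‖ ≤ √(F₂ (s + s)) * √(F₁ x) * ‖f‖ := by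
        refine le_of_pow_le_pow_left₀ two_ne_zero (by positivity) ?_
        rw [mul_pow, mul_pow, Real.sq_sqrt hm.le, Real.sq_sqrt (hpos x).le]
        refine h4.trans (mul_le_mul_of_nonneg_right ?_ (sq_nonneg _))
        rw [mul_comm]
        exact hpF _ (add_pos hs hs) x
      calc ‖W x‖ * ‖kernelIntegral p μ s f x‖
          ≤ ‖W x‖ * (√(F₂ (s + s)) * √(F₁ x) * ‖f‖) :=
            mul_le_mul_of_nonneg_left h5 (norm_nonneg _)
        _ = _ := by ring
  refine ⟨M ∘L R, ?_, fun f => hM (R f)⟩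
  refine isCompactOperator_of_forall_exists_norm_sub_le fun ε hε => ?_
  -- The approximation error is at most `C * s`, and this `s` keeps it below `ε` even when `C = 0`.
  have hs : 0 < ε / (C + 1) := by positivity
  set s := ε / (C + 1) with hsdef
  refine ⟨(M ∘L semigroup p μ hp s) ∘L ((Real.exp (-a * s) : ℂ) • R),
    (hcomp s hs).comp_clm _, fun f => ?_⟩
  have e : (M ∘L R) f -
      ((M ∘L semigroup p μ hp s) ∘L ((Real.exp (-a * s) : ℂ) • R)) f =
      M (R f - (Real.exp (-a * s) : ℂ) • semigroup p μ hp s (R f)) := by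
    simp only [ContinuousLinearMap.comp_apply, smul_apply, map_sub, map_smul]
  rw [e]
  refine (hMC _).trans ?_
  have h1 := norm_laplaceTransform_sub_le (isSymmetricSemigroup_semigroup hp) ha hs f
  calc C * ‖R f - (Real.exp (-a * s) : ℂ) • semigroup p μ hp s (R f)‖
      ≤ C * (s * ‖f‖) := mul_le_mul_of_nonneg_left h1 hC
    _ = C * s * ‖f‖ := by ring
    _ ≤ ε * ‖f‖ := by
      refine mul_le_mul_of_nonneg_right ?_ (norm_nonneg _)
      rw [hsdef, mul_div_assoc', div_le_iff₀ (by positivity)]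
      nlinarith

end Potentials

/-! ### Scalar Laplace integrals for large parameter -/

section LaplaceBounds

variable {φ : ℝ → ℝ} {b : ℝ}

theorem integrableOn_exp_mul_of_le
    (h : IntegrableOn (fun t => Real.exp (-b * t) * φ t) (Set.Ioi 0)) {a : ℝ} (ha : b ≤ a) :
    IntegrableOn (fun t => Real.exp (-a * t) * φ t) (Set.Ioi 0) := by
  have he : ∀ t, Real.exp (-a * t) * φ t =
      Real.exp (-(a - b) * t) * (Real.exp (-b * t) * φ t) := fun t => by
    rw [← mul_assoc, ← Real.exp_add]; ring_nf
  simp_rw [he]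
  refine Integrable.mono h (AEStronglyMeasurable.mul (by fun_prop) h.aestronglyMeasurable) ?_
  refine (ae_restrict_iff' measurableSet_Ioi).2 (Eventually.of_forall fun t ht => ?_)
  have ht : 0 < t := ht
  rw [norm_mul, Real.norm_of_nonneg (Real.exp_pos _).le]
  refine mul_le_of_le_one_left (norm_nonneg _) (Real.exp_le_one_iff.2 ?_)
  nlinarith

theorem tendsto_integral_exp_mul
    (h : IntegrableOn (fun t => Real.exp (-b * t) * φ t) (Set.Ioi 0)) :
    Tendsto (fun a : ℝ => ∫ t in Set.Ioi (0 : ℝ), Real.exp (-a * t) * φ t) atTop (𝓝 0) := by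
  suffices h0 : Tendsto (fun a : ℝ => ∫ t in Set.Ioi (0 : ℝ), Real.exp (-a * t) * φ t) atTop
      (𝓝 (∫ _ in Set.Ioi (0 : ℝ), (0 : ℝ))) by
    simpa only [integral_zero] using h0
  refine tendsto_integral_filter_of_dominated_convergence
    (fun t => ‖Real.exp (-b * t) * φ t‖) ?_ ?_ h.norm ?_
  · filter_upwards [eventually_ge_atTop b] with a ha
    exact (integrableOn_exp_mul_of_le h ha).aestronglyMeasurable
  · filter_upwards [eventually_ge_atTop b] with a ha
    refine (ae_restrict_iff' measurableSet_Ioi).2 (Eventually.of_forall fun t ht => ?_)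
    have ht : 0 < t := ht
    rw [norm_mul, norm_mul, Real.norm_of_nonneg (Real.exp_pos _).le,
      Real.norm_of_nonneg (Real.exp_pos _).le]
    refine mul_le_mul_of_nonneg_right (Real.exp_le_exp.2 ?_) (norm_nonneg _)
    nlinarith
  · refine (ae_restrict_iff' measurableSet_Ioi).2 (Eventually.of_forall fun t ht => ?_)
    have ht : 0 < t := ht
    have h1 : Tendsto (fun a : ℝ => Real.exp (-a * t)) atTop (𝓝 0) := by
      refine Real.tendsto_exp_atBot.comp ?_
      simp_rw [neg_mul]
      exact tendsto_neg_atTop_atBot.comp (tendsto_id.atTop_mul_const ht)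
    simpa using h1.mul_const (φ t)

end LaplaceBounds

/-! ### Relative compactness of the potential -/

section RelativeCompactness

variable {X : Type*} [MeasurableSpace X] {p : ℝ → X → X → ℝ≥0} {μ : Measure X} [SigmaFinite μ]
  {F₁ : X → ℝ} {q : ℝ}

/-- `(H_p + a)⁻¹`. -/
noncomputable def heatResolvent (hp : IsHeatKernel p μ) {a : ℝ} (ha : 0 < a) :
    Lp ℂ 2 μ →L[ℂ] Lp ℂ 2 μ :=
  laplaceTransform (isSymmetricSemigroup_semigroup hp) ha

theorem isResolventAt_heatResolvent (hp : IsHeatKernel p μ) {a : ℝ} (ha : 0 < a) :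
    IsResolventAt (hamiltonian p μ hp) (-(a : ℂ)) (heatResolvent hp ha) :=
  isResolventAt_laplaceTransform (isSymmetricSemigroup_semigroup hp) ha

/-- Potentials in `L^{2q}(F₁ μ)` are relatively compact, with relative bound zero. -/
theorem exists_isMulComp_of_memLp (hp : IsHeatKernel p μ) (hq : 1 ≤ q)
    (hF : IsControlFunction p q F₁) {W : X → ℂ}
    (hW : MemLp W (ENNReal.ofReal (2 * q)) (weighted μ F₁)) :
    ∃ c : ℝ → ℝ, Tendsto c atTop (𝓝 0) ∧ ∀ (a : ℝ) (ha : 0 < a), 2 ≤ a →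
      ∃ K : Lp ℂ 2 μ →L[ℂ] Lp ℂ 2 μ, IsCompactOperator K ∧ IsMulComp W (heatResolvent hp ha) K ∧
        ∀ f, ‖K f‖ ≤ c a * ‖f‖ := by
  obtain ⟨hFm, hpos, F₂, -, hF₂, hpF, hintg⟩ := hF
  have hac : μ ≪ weighted μ F₁ := absolutelyContinuous_weighted hFm hpos
  have h2q : ENNReal.ofReal (2 * q) ≠ 0 := by
    rw [ne_eq, ENNReal.ofReal_eq_zero, not_le]; linarith
  set φ : ℝ → ℝ := fun t => F₂ (t + t) ^ (1 / (2 * q)) with hφ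
  have hφ0 : ∀ t, 0 < t → 0 ≤ φ t := fun t ht => Real.rpow_nonneg (hF₂ _ (add_pos ht ht)).le _
  -- The control integral after `t ↦ 2t`: the doubled time in `p(2t,x,x)` turns the weight `e^{-t}`
  -- into `e^{-2t}`, whence the threshold `2 ≤ a`.
  have hφ2 : IntegrableOn (fun t => Real.exp (-2 * t) * φ t) (Set.Ioi 0) := by
    have h := (integrableOn_Ioi_comp_mul_left_iff
      (fun t => Real.exp (-t) * F₂ t ^ (1 / (2 * q))) 0 (two_pos (α := ℝ))).2 (by simpa using hintg)
    refine h.congr (Eventually.of_forall fun t => ?_)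
    simp only [hφ, two_mul, neg_mul]
  set I : ℝ → ℝ := fun a => ∫ t in Set.Ioi (0 : ℝ), Real.exp (-a * t) * φ t with hI
  have hI0 : ∀ a, 0 ≤ I a := fun a => setIntegral_nonneg measurableSet_Ioi fun t ht =>
    mul_nonneg (Real.exp_pos _).le (hφ0 t ht)
  have hbound : ∀ (W : X → ℂ), AEStronglyMeasurable W μ → ∀ N : ℝ, 0 ≤ N →
      eLpNorm W (ENNReal.ofReal (2 * q)) (weighted μ F₁) ≤ ENNReal.ofReal N →
      ∀ (a : ℝ) (ha : 0 < a), 2 ≤ a → ∀ f, eLpNorm (fun x => W x * heatResolvent hp ha f x) 2 μ ≤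
        ENNReal.ofReal (N * I a * ‖f‖) := by
    intro W hW N hN hWN a ha ha2 f
    refine eLpNorm_mul_laplaceTransform_le hp hW ha hN (integrableOn_exp_mul_of_le hφ2 ha2) hφ0
      (fun t ht f => ?_) f
    rw [ENNReal.ofReal_mul hN]
    exact (eLpNorm_mul_semigroup_le hp hFm hq ht (hF₂ _ (add_pos ht ht))
      (hpF _ (add_pos ht ht)) hW f).trans (mul_le_mul_left hWN _)
  set N := (eLpNorm W (ENNReal.ofReal (2 * q)) (weighted μ F₁)).toReal with hN
  have hWμ : AEStronglyMeasurable W μ := hW.1.mono_ac hac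
  refine ⟨fun a => N * I a, by
    simpa only [mul_zero] using (tendsto_integral_exp_mul hφ2).const_mul N,
    fun a ha ha2 => ?_⟩
  have hWb := hbound W hWμ N ENNReal.toReal_nonneg (ENNReal.ofReal_toReal hW.2.ne).ge a ha ha2
  obtain ⟨K, hK, hKW⟩ := exists_isCompactOperator_isMulComp hWμ (R := heatResolvent hp ha)
    fun ε hε => by
      have hδ : 0 < ε / (I a + 1) := div_pos hε (by linarith [hI0 a])
      obtain ⟨s, hs, hsm⟩ := hW.exists_simpleFunc_eLpNorm_sub_lt ENNReal.ofReal_ne_top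
        (ENNReal.ofReal_pos.2 hδ).ne'
      obtain ⟨C, hC⟩ := s.exists_forall_norm_le
      -- For simple functions both integrability conditions mean support of finite measure, so the
      -- exponent may be changed from `2q` to `2`.
      have hs2 : MemLp s 2 (weighted μ F₁) :=
        (SimpleFunc.memLp_iff_finMeasSupp two_ne_zero ENNReal.ofNat_ne_top).2
          ((SimpleFunc.memLp_iff_finMeasSupp h2q ENNReal.ofReal_ne_top).1 hsm)
      obtain ⟨K', hK', hsK'⟩ := exists_isCompactOperator_of_bounded hp hFm hpos hF₂ hpF
        (le_max_right C 0) (Eventually.of_forall fun x => (hC x).trans (le_max_left C 0)) hs2 ha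
      have hsμ : AEStronglyMeasurable s μ := s.aestronglyMeasurable
      refine ⟨s, K', hsμ, hK', hsK', fun f => ?_⟩
      refine (hbound (fun x => W x - s x) (hWμ.sub hsμ) _ hδ.le hs.le a ha ha2 f).trans
        (ENNReal.ofReal_le_ofReal (mul_le_mul_of_nonneg_right ?_ (norm_nonneg _)))
      rw [div_mul_eq_mul_div, div_le_iff₀ (by linarith [hI0 a])]
      nlinarith [hI0 a]
  exact ⟨K, hK, hKW, fun f => Lp_norm_le_of_ae_eq
    (mul_nonneg (mul_nonneg ENNReal.toReal_nonneg (hI0 a)) (norm_nonneg _)) (hKW f) (hWb f)⟩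

/-- Bounded potentials that vanish weakly at infinity with respect to `F₁ μ` are relatively
compact, with relative bound zero. -/
theorem exists_isMulComp_of_vanishesWeakly (hp : IsHeatKernel p μ)
    (hF : IsControlFunction p q F₁) {V : X → ℝ} (hV : MemLp V ∞ μ)
    (hVw : VanishesWeakly (weighted μ F₁) V) :
    ∃ c : ℝ → ℝ, Tendsto c atTop (𝓝 0) ∧ ∀ (a : ℝ) (ha : 0 < a),
      ∃ K : Lp ℂ 2 μ →L[ℂ] Lp ℂ 2 μ, IsCompactOperator K ∧
        IsMulComp (fun x => (V x : ℂ)) (heatResolvent hp ha) K ∧ ∀ f, ‖K f‖ ≤ c a * ‖f‖ := by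
  obtain ⟨hFm, hpos, F₂, -, hF₂, hpF, -⟩ := hF
  set C := (eLpNorm V ∞ μ).toReal with hC
  have hC0 : 0 ≤ C := ENNReal.toReal_nonneg
  have hVC : ∀ᵐ x ∂μ, ‖V x‖ ≤ C := by
    filter_upwards [ae_le_eLpNormEssSup (f := V) (μ := μ)] with x hx
    rw [← toReal_enorm]
    refine ENNReal.toReal_mono hV.2.ne ?_
    rwa [eLpNorm_exponent_top]
  have hVCc : ∀ᵐ x ∂μ, ‖(V x : ℂ)‖ ≤ C := by simpa using hVC
  have hVm : AEStronglyMeasurable (fun x => (V x : ℂ)) μ :=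
    Complex.continuous_ofReal.comp_aestronglyMeasurable hV.1
  have hVν : AEStronglyMeasurable (fun x => (V x : ℂ)) (weighted μ F₁) :=
    Complex.continuous_ofReal.comp_aestronglyMeasurable hVw.1
  have hνac : weighted μ F₁ ≪ μ := withDensity_absolutelyContinuous _ _
  have hRa : ∀ (a : ℝ) (ha : 0 < a) (c : ℝ) (f : Lp ℂ 2 μ), 0 ≤ c →
      c * ‖heatResolvent hp ha f‖ ≤ c * a⁻¹ * ‖f‖ := fun a ha c f hc =>
    (mul_le_mul_of_nonneg_left (norm_laplaceTransform_apply_le _ ha f) hc).trans_eq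
      (mul_assoc _ _ _).symm
  refine ⟨fun a => C * a⁻¹, by simpa using tendsto_inv_atTop_zero.const_mul C, fun a ha => ?_⟩
  obtain ⟨K, hK, hKV⟩ := exists_isCompactOperator_isMulComp hVm (R := heatResolvent hp ha)
    fun ε hε => by
      have hδ : 0 < ε * a := mul_pos hε ha
      -- Off `A` the potential is below `ε * a`, so the discarded part contributes at most `ε`
      -- because the resolvent has norm at most `a⁻¹`. On `A`, of finite weighted measure,
      -- boundedness gives square integrability.
      set A : Set X := {x | ε * a ≤ |V x|} with hA
      have hAν : NullMeasurableSet A (weighted μ F₁) :=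
        nullMeasurableSet_le aemeasurable_const hVw.1.norm.aemeasurable
      have hAμ : NullMeasurableSet A μ :=
        nullMeasurableSet_le aemeasurable_const hV.1.norm.aemeasurable
      set W : X → ℂ := A.indicator fun x => (V x : ℂ) with hW
      have hWC : ∀ᵐ x ∂μ, ‖W x‖ ≤ C := by
        filter_upwards [hVCc] with x hx
        exact (norm_indicator_le_norm_self _ _).trans hx
      have hW2 : MemLp W 2 (weighted μ F₁) := by
        refine ⟨hVν.indicator₀ hAν, ?_⟩
        rw [eLpNorm_lt_top_iff_lintegral_rpow_enorm_lt_top (by norm_num) (by norm_num)]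
        refine lt_of_le_of_lt ((lintegral_mono_ae ?_).trans
          (lintegral_indicator_const_le A (ENNReal.ofReal C ^ (2 : ℝ))))
          (ENNReal.mul_lt_top (by finiteness) (hVw.2 _ hδ))
        filter_upwards [hνac.ae_le hVCc] with x hx
        by_cases hxA : x ∈ A
        · simp only [hW, Set.indicator_of_mem hxA, ENNReal.toReal_ofNat]
          refine ENNReal.rpow_le_rpow ?_ (by norm_num)
          rw [← ofReal_norm]
          exact ENNReal.ofReal_le_ofReal hx
        · simp [hW, Set.indicator_of_notMem hxA]
      obtain ⟨K', hK', hWK'⟩ :=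
        exists_isCompactOperator_of_bounded hp hFm hpos hF₂ hpF hC0 hWC hW2 ha
      refine ⟨W, K', hVm.indicator₀ hAμ, hK', hWK', fun f => ?_⟩
      refine (eLpNorm_mul_le_of_ae_norm_le hδ.le (Eventually.of_forall fun x => ?_)
        (heatResolvent hp ha f)).trans (ENNReal.ofReal_le_ofReal ?_)
      · by_cases hxA : x ∈ A
        · simpa [hW, Set.indicator_of_mem hxA] using hδ.le
        · have : |V x| < ε * a := not_le.1 hxA
          simpa [hW, Set.indicator_of_notMem hxA] using this.le
      · refine (hRa a ha _ f hδ.le).trans_eq ?_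
        rw [mul_assoc ε, mul_inv_cancel₀ ha.ne', mul_one]
  refine ⟨K, hK, hKV, fun f => ?_⟩
  refine (Lp_norm_le_of_ae_eq (by positivity) (hKV f)
    (eLpNorm_mul_le_of_ae_norm_le hC0 hVCc _)).trans (hRa a ha C f hC0)

theorem exists_isMulComp_add (hp : IsHeatKernel p μ) (hq : 1 ≤ q)
    (hF : IsControlFunction p q F₁) {V V₁ V₂ : X → ℝ} (hV : ∀ᵐ x ∂μ, V x = V₁ x + V₂ x)
    (hV₁ : MemLp V₁ (ENNReal.ofReal (2 * q)) (weighted μ F₁)) (hV₂ : MemLp V₂ ∞ μ)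
    (hV₂w : VanishesWeakly (weighted μ F₁) V₂) :
    ∃ c : ℝ → ℝ, Tendsto c atTop (𝓝 0) ∧ ∀ (a : ℝ) (ha : 0 < a), 2 ≤ a →
      ∃ K : Lp ℂ 2 μ →L[ℂ] Lp ℂ 2 μ, IsCompactOperator K ∧
        IsMulComp (fun x => (V x : ℂ)) (heatResolvent hp ha) K ∧ ∀ f, ‖K f‖ ≤ c a * ‖f‖ := by
  obtain ⟨c₁, hc₁, h₁⟩ := exists_isMulComp_of_memLp hp hq hF (hV₁.ofReal (K := ℂ))
  obtain ⟨c₂, hc₂, h₂⟩ := exists_isMulComp_of_vanishesWeakly hp hF hV₂ hV₂w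
  refine ⟨fun a => c₁ a + c₂ a, by simpa using hc₁.add hc₂, fun a ha ha2 => ?_⟩
  obtain ⟨K₁, hK₁, hm₁, hn₁⟩ := h₁ a ha ha2
  obtain ⟨K₂, hK₂, hm₂, hn₂⟩ := h₂ a ha
  refine ⟨K₁ + K₂, hK₁.add hK₂, (hm₁.add hm₂).congr ?_, fun f => ?_⟩
  · filter_upwards [hV] with x hx
    simp [hx]
  · rw [add_mul]
    exact (norm_add_le _ _).trans (add_le_add (hn₁ f) (hn₂ f))

/-- The resolvent identity `R_a = R_b (1 + (b - a) R_a)` carries compactness from one parameter `b`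
to every `a > 0`. -/
theorem IsMulComp.of_heatResolvent (hp : IsHeatKernel p μ) {a b : ℝ} (ha : 0 < a) (hb : 0 < b)
    {W : X → ℂ} {K : Lp ℂ 2 μ →L[ℂ] Lp ℂ 2 μ} (h : IsMulComp W (heatResolvent hp hb) K) :
    IsMulComp W (heatResolvent hp ha) (K ∘L (1 + ((b : ℂ) - a) • heatResolvent hp ha)) := by
  have h1 := h.comp (1 + ((b : ℂ) - a) • heatResolvent hp ha)
  have h2 : heatResolvent hp hb ∘L (1 + ((b : ℂ) - a) • heatResolvent hp ha) =
      heatResolvent hp ha := by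
    ext1 f
    rw [(isResolventAt_heatResolvent hp hb).identity (isResolventAt_heatResolvent hp ha) f]
    simp only [ContinuousLinearMap.comp_apply, add_apply, one_apply_eq_self, smul_apply, map_add,
      map_smul]
    rw [neg_sub_neg]
  rwa [h2] at h1

theorem isFormalAdjoint_hamiltonian (hp : IsHeatKernel p μ) :
    (hamiltonian p μ hp).IsFormalAdjoint (hamiltonian p μ hp) :=
  (isSymmetricSemigroup_semigroup hp).isFormalAdjoint_generator

theorem isFormalAdjoint_schrodinger (hp : IsHeatKernel p μ) (V : X → ℝ) :
    (schrodinger p μ hp V).IsFormalAdjoint (schrodinger p μ hp V) :=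
  isFormalAdjoint_add (isFormalAdjoint_hamiltonian hp) (isFormalAdjoint_mulOperator V)

end RelativeCompactness

end HeatKernel

/-! ### The main theorem -/

theorem mainTheorem1 {X : Type*} [MeasurableSpace X] (μ : MeasureTheory.Measure X)
    [MeasureTheory.SigmaFinite μ] (p : ℝ → X → X → ℝ≥0) (hp : HeatKernel.IsHeatKernel p μ)
    (q : ℝ) (hq : 1 ≤ q) (F₁ : X → ℝ) (hF₁ : HeatKernel.IsControlFunction p q F₁)
    (V V₁ V₂ : X → ℝ) (hV : ∀ᵐ x ∂μ, V x = V₁ x + V₂ x)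
    (hcond :
      (q = 1 ∧ MemLp V₁ 2 (HeatKernel.weighted μ F₁) ∧
        HeatKernel.VanishesWeakly (HeatKernel.weighted μ F₁) V₂ ∧
        MemLp V₂ ∞ μ ∧ HeatKernel.VanishesWeakly μ V₂) ∨
      (1 < q ∧ (∀ x, F₁ x = 1) ∧ MemLp V₁ (ENNReal.ofReal (2 * q)) μ ∧
        MemLp V₂ ∞ μ ∧ HeatKernel.VanishesWeakly μ V₂)) :
    (∀ a : ℝ, 0 < a → ∃ R K : Lp ℂ 2 μ →L[ℂ] Lp ℂ 2 μ,
      HeatKernel.IsResolventAt (HeatKernel.hamiltonian p μ hp) (-(a : ℂ)) R ∧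
        IsCompactOperator K ∧
        ∀ f, ∃ h : R f ∈ (HeatKernel.mulOperator μ fun x => (V x : ℂ)).domain,
          HeatKernel.mulOperator μ (fun x => (V x : ℂ)) ⟨R f, h⟩ = K f) ∧
    (HeatKernel.schrodinger p μ hp V).domain = (HeatKernel.hamiltonian p μ hp).domain ∧
    IsSelfAdjoint (HeatKernel.schrodinger p μ hp V) ∧
    (∃ c : ℝ, ∀ f : (HeatKernel.schrodinger p μ hp V).domain,
      c * ‖(f : Lp ℂ 2 μ)‖ ^ 2 ≤
        (inner ℂ (f : Lp ℂ 2 μ) (HeatKernel.schrodinger p μ hp V f)).re) ∧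
    HeatKernel.essentialSpectrum (HeatKernel.schrodinger p μ hp V) =
      HeatKernel.essentialSpectrum (HeatKernel.hamiltonian p μ hp) := by
  -- The two cases merge: for `q = 1` the exponent `2q` is `2`, and for `q > 1` the weighted measure
  -- is `μ`.
  have hmem : MemLp V₁ (ENNReal.ofReal (2 * q)) (HeatKernel.weighted μ F₁) ∧ MemLp V₂ ∞ μ ∧
      HeatKernel.VanishesWeakly (HeatKernel.weighted μ F₁) V₂ := by
    rcases hcond with ⟨rfl, h1, h2, h3, -⟩ | ⟨-, hF, h1, h2, h3⟩
    · exact ⟨by simpa using h1, h3, h2⟩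
    · have hμ : HeatKernel.weighted μ F₁ = μ := by
        simp [HeatKernel.weighted, hF]
      rw [hμ]
      exact ⟨h1, h2, h3⟩
  obtain ⟨c, hc, hK⟩ := HeatKernel.exists_isMulComp_add hp hq hF₁ hV hmem.1 hmem.2.1 hmem.2.2
  -- Beyond `a₀` the relative bound is below `1/2`, so the Neumann series converges for every `a ≥
  -- a₀`; the whole half-line is needed for the lower bound `-a₀`.
  obtain ⟨a₀, ha₀⟩ := eventually_atTop.1
    ((hc.eventually_lt_const (one_half_pos (α := ℝ))).and (eventually_ge_atTop 2))
  have hres : ∀ a : ℝ, a₀ ≤ a → ∃ R K L B : Lp ℂ 2 μ →L[ℂ] Lp ℂ 2 μ, IsCompactOperator K ∧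
      HeatKernel.IsResolventAt (HeatKernel.hamiltonian p μ hp) ((-a : ℝ) : ℂ) R ∧
      HeatKernel.IsResolventAt (HeatKernel.schrodinger p μ hp V) ((-a : ℝ) : ℂ) B ∧
      B - R = -(R ∘L K ∘L L) ∧
      ∀ f, R f ∈ (HeatKernel.mulOperator μ fun x => (V x : ℂ)).domain := by
    intro a ha
    obtain ⟨hca, h2a⟩ := ha₀ a ha
    have hpos : 0 < a := by linarith
    obtain ⟨K, hKc, hKm, hKn⟩ := hK a hpos h2a
    have hR := HeatKernel.isResolventAt_heatResolvent hp hpos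
    rw [← Complex.ofReal_neg] at hR
    have hK1 : ‖K‖ < 1 := by
      refine (ContinuousLinearMap.opNorm_le_bound _ (by norm_num : (0 : ℝ) ≤ 1 / 2)
        fun f => (hKn f).trans ?_).trans_lt one_half_lt_one
      exact mul_le_mul_of_nonneg_right hca.le (norm_nonneg _)
    obtain ⟨B, L, hB, hBL⟩ := hR.exists_add hKm.exists_mulOperator_eq hK1
    exact ⟨_, K, L, B, hKc, hR, hB, hBL, fun f => (hKm.exists_mulOperator_eq f).choose⟩
  have hsymm := HeatKernel.isFormalAdjoint_schrodinger hp V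
  obtain ⟨R, K, L, B, hKc, hR, hB, hBL, hdom⟩ := hres a₀ le_rfl
  refine ⟨fun a ha => ?_, ?_, hB.isSelfAdjoint_pmap hsymm, ⟨-a₀, ?_⟩, ?_⟩
  · obtain ⟨K, hKc, hKm, -⟩ := hK 2 two_pos le_rfl
    exact ⟨_, _, HeatKernel.isResolventAt_heatResolvent hp ha, hKc.comp_clm _,
      (hKm.of_heatResolvent hp ha two_pos).exists_mulOperator_eq⟩
  · exact inf_eq_left.2 (hR.domain_le hdom)
  · refine HeatKernel.le_re_inner_of_isResolventAt hsymm fun a ha => ?_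
    obtain ⟨-, -, -, B, -, -, hB, -⟩ := hres (-a) (le_neg_of_le_neg ha)
    rw [neg_neg] at hB
    exact ⟨B, hB⟩
  · refine HeatKernel.essentialSpectrum_eq_of_isCompactOperator_sub
      (HeatKernel.isFormalAdjoint_hamiltonian hp) hsymm hR hB ?_
    rw [hBL]
    exact ((hKc.comp_clm L).clm_comp R).neg
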